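/- Let $\mathcal F$ be the ring of holomorphic functions on the upper half plane $\mathcal H$, let $\Gamma\subset SL(2,\mathbb R)$ be a discrete subgroup and let $m\ge 0$ be an integer. For $\gamma=\begin{pmatrix}a&b\\c&d\end{pmatrix}$ put $\mathfrak J(\gamma,z)=cz+d$ and $\mathfrak K(\gamma,z)=c/(cz+d)$. **Spaces.** $QP^m_\ell(\Gamma)$ is the space of polynomials $F(z,X)$ in $X$ over $\mathcal F$ of degree at most $m$ with $\mathfrak J(\gamma,z)^{-\ell}F(\gamma z,\mathfrak J(\gamma,z)^2(X-\mathfrak K(\gamma,z)))=F(z,X)$ for all $\gamma\in\Gamma$, and $\widehat{\mathcal F}_m=\bigoplus_{\ell\ge0}QP^m_\ell(\Gamma)$. For $\lambda\in\mathbb Z$ and an integer $\delta\ge0$, $\mathcal J_\lambda(\Gamma)_\delta$ is the space of $\Phi\in X^\delta\mathcal F[[X]]$ with $\mathfrak J(\gamma,z)^{-\lambda}e^{-\mathfrak K(\gamma,z)X}\Phi(\gamma z,\mathfrak J(\gamma,z)^{-2}X)=\Phi(z,X)$ for all $\gamma\in\Gamma$. A pseudodifferential operator is a formal series $\Psi=\sum_{k\le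 u}h_k\partial^k$ ($u\in\mathbb Z$, $h_k\in\mathcal F$, $\partial=d/dz$), multiplied by the Leibniz rule $\partial^k g=\sum_{q\ge0}\binom kq g^{(q)}\partial^{k-q}$ ($k\in\mathbb Z$), with commutator $[\Psi,\Phi]^\partial=\Psi\Phi-\Phi\Psi$. For $\alpha\in\mathbb Z$, $\Psi\mathcal D(\mathcal F)^\Gamma_{\alpha}$ is the space of those of order at most $\alpha$ with $\sum_k h_k(\gamma z)(\mathfrak J(\gamma,z)^2\partial)^k=\Psi$ for all $\gamma\in\Gamma$. **Maps.** For $\eta>0$ let $C_\eta=(-1)^\eta\eta!(\eta-1)!$. Put $$\Pi^\delta_m\Big(\sum_{k\ge0}\phi_kX^{k+\delta}\Big)=\sum_{r=0}^m\frac{\phi_{m-r}}{r!}X^r,\qquad {}^\partial\Pi^{-\varepsilon}_m\Big(\sum_{k\ge0}\psi_k\partial^{-k-\varepsilon}\Big)=\sum_{r=0}^m\frac{\psi_{m-r}}{r!\,C_{m-r+\varepsilon}}X^r\quad(\varepsilon>0),$$ $$\mathcal I^\partial_\xi\Big(\sum_{k\ge0} f_kX^{k+\delta}\Big)=\sum_{k\ge0}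 C_{k+\delta+\xi}f_k\,\partial^{-k-\delta-\xi}\quad(\xi\in\mathbb Z,\ \delta+\xi>0).$$ **Brackets.** For integers $r\ge p\ge q\ge0$ and $\alpha,\beta>0$ let $$\Xi^{r,p,q}_{\alpha,\beta}=\frac{(r-p+\alpha)!\,(r-p+q+\alpha-1)!\,(p-q+\beta)!\,(p-q+\beta-1)!}{q!\,(r+\alpha+\beta)!\,(r+\alpha+\beta-1)!}.$$ For $F=\sum f_kX^{k+\delta_1}$ and $G=\sum g_kX^{k+\delta_2}$, given the weights $2\xi_1,2\xi_2$ with $\xi_i\in\mathbb Z$, $\delta_i+\xi_i>0$, let $$[F,G]^X=\sum_{r\ge0}\sum_{p=0}^r\sum_{q=0}^p\Big(\Xi^{r,p,q}_{\delta_1+\xi_1,\delta_2+\xi_2}f_{r-p}g^{(q)}_{p-q}-\Xi^{r,p,q}_{\delta_2+\xi_2,\delta_1+\xi_1}g_{r-p}f^{(q)}_{p-q}\Big)X^{r+\delta_1+\delta_2}.$$ For integers $\xi_1,\xi_2>m$ and $F_i=\sum_{r=0}^m f_{i,r}X^r\in QP^m_{2\xi_i}(\Gamma)$ let $$[F_1,F_2]^Q=\sum_{r=0}^m\sum_{p=0}^{m-r}\sum_{q=0}^p\frac{(r+p)!\,(m-p+q)!}{r!}\Big(\Xi^{m-r,p,q}_{\xi_1-m,\,\xi_2-m}f_{1,r+p}f^{(q)}_{2,m-p+q}-\Xi^{m-r,p,q}_{\xi_2-m,\,\xi_1-m}f_{2,r+p}f^{(q)}_{1,m-p+q}\Big)X^r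 .$$ **Theorem.** 1. For all integers $\xi_1,\xi_2>m$ and $F_i\in QP^m_{2\xi_i}(\Gamma)$ we have $[F_1,F_2]^Q\in QP^m_{2\xi_1+2\xi_2-2m}(\Gamma)$. The bilinear map on $\widehat{\mathcal F}_m$ given by $[\cdot,\cdot]^Q$ on $QP^m_{2\xi_1}(\Gamma)\times QP^m_{2\xi_2}(\Gamma)$ for $\xi_1,\xi_2>m$, and by $0$ on $QP^m_{\ell_1}(\Gamma)\times QP^m_{\ell_2}(\Gamma)$ whenever $\ell_1$ or $\ell_2$ is odd or at most $2m$ (where the formula is not defined), is a Lie bracket. In particular $[\cdot,\cdot]^Q$ is a Lie bracket on $\bigoplus_{\xi>m}QP^m_{2\xi}(\Gamma)$. 2. Let $\xi_1,\xi_2>m$ and $\delta_1,\delta_2\ge0$ be integers and $\Phi_i\in\mathcal J_{2(\xi_i-m-\delta_i)}(\Gamma)_{\delta_i}$. Then $\Pi^{\delta_i}_m\Phi_i\in QP^m_{2\xi_i}(\Gamma)$, the bracket $[\Phi_1,\Phi_2]^X$ (formed with the weights $2(\xi_i-m-\delta_i)$) lies in $\mathcal J_{2(\xi_1+\xi_2-2m-\delta_1-\delta_2)}(\Gamma)_{\delta_1+\delta_2}$,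 and $$\Pi^{\delta_1+\delta_2}_m[\Phi_1,\Phi_2]^X=[\Pi^{\delta_1}_m\Phi_1,\Pi^{\delta_2}_m\Phi_2]^Q .$$ 3. The bracket $[\cdot,\cdot]^X$ is transported from the commutator: for $F\in X^{\delta_1}\mathcal F[[X]]$, $G\in X^{\delta_2}\mathcal F[[X]]$ with $\delta_i\ge0$, $\xi_i\in\mathbb Z$, $\delta_i+\xi_i>0$, $$\mathcal I^\partial_{\xi_1+\xi_2}\big([F,G]^X\big)=[\mathcal I^\partial_{\xi_1}F,\mathcal I^\partial_{\xi_2}G]^\partial .$$ 4. Let $\xi_1,\xi_2>m$ be integers and $\Psi_i\in\Psi\mathcal D(\mathcal F)^\Gamma_{m-\xi_i}$. Then ${}^\partial\Pi^{m-\xi_i}_m\Psi_i\in QP^m_{2\xi_i}(\Gamma)$, $[\Psi_1,\Psi_2]^\partial\in\Psi\mathcal D(\mathcal F)^\Gamma_{2m-\xi_1-\xi_2}$, and $${}^\partial\Pi^{2m-\xi_1-\xi_2}_m[\Psi_1,\Psi_2]^\partial=[{}^\partial\Pi^{m-\xi_1}_m\Psi_1,{}^\partial\Pi^{m-\xi_2}_m\Psi_2]^Q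 .$$ -/

import Mathlib

open scoped MatrixGroups Manifold Nat

noncomputable section

namespace QuasiLie

open UpperHalfPlane

/-! ### Holomorphic functions on the upper half plane -/

/-- The ring of holomorphic functions on the upper half plane. -/
def Hol : Subalgebra ℂ (ℍ → ℂ) where
  carrier := {f | MDifferentiable 𝓘(ℂ, ℂ) 𝓘(ℂ, ℂ) f}
  mul_mem' := fun hf hg => hf.mul hg
  add_mem' := fun hf hg => hf.add hg
  algebraMap_mem' := fun _ => mdifferentiable_const

theorem deriv_mem_Hol (f : Hol) :
    (fun z : ℍ => deriv ((f : ℍ → ℂ) ∘ ofComplex) (z : ℂ)) ∈ Hol := by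
  have hf : DifferentiableOn ℂ ((f : ℍ → ℂ) ∘ ofComplex) {z | 0 < z.im} :=
    UpperHalfPlane.mdifferentiable_iff.mp f.2
  refine UpperHalfPlane.mdifferentiable_iff.mpr
    ((hf.deriv isOpen_upperHalfPlaneSet).congr fun z hz => ?_)
  simp only [Function.comp_apply, ofComplex_apply_of_im_pos hz]

/-- The derivative `d/dz` of a holomorphic function on the upper half plane. -/
def D (f : Hol) : Hol := ⟨fun z : ℍ => deriv ((f : ℍ → ℂ) ∘ ofComplex) (z : ℂ), deriv_mem_Hol f⟩

/-- The automorphy factor `J(γ, z) = c z + d`, as an invertible holomorphic function of `z`. -/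
def J (γ : SL(2, ℝ)) : Holˣ where
  val := ⟨fun z => denom γ z, mdifferentiable_denom _⟩
  inv := ⟨fun z => (denom γ z)⁻¹, mdifferentiable_inv_denom _⟩
  val_inv := by ext z; exact mul_inv_cancel₀ (denom_ne_zero _ z)
  inv_val := by ext z; exact inv_mul_cancel₀ (denom_ne_zero _ z)

/-- The function `K(γ, z) = c / (c z + d)`. -/
def K (γ : SL(2, ℝ)) : Hol := ((γ 1 0 : ℝ) : ℂ) • ((J γ)⁻¹ : Holˣ)

/-- The ring homomorphism `f(z) ↦ f(γ z)`. -/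
def pull (γ : SL(2, ℝ)) : Hol →ₐ[ℂ] Hol where
  toFun f := ⟨fun z => (f : ℍ → ℂ) (γ • z), f.2.comp (mdifferentiable_smul (by simp))⟩
  map_one' := rfl
  map_mul' _ _ := rfl
  map_zero' := rfl
  map_add' _ _ := rfl
  commutes' _ := rfl

/-! ### Jacobi-like forms and quasimodular polynomials -/

/-- `(Φ |^J_w γ)(z, X) = J(γ,z)^{-w} e^{-K(γ,z) X} Φ(γ z, J(γ,z)^{-2} X)`. -/
def slashJ (w : ℤ) (γ : SL(2, ℝ)) (Φ : PowerSeries Hol) : PowerSeries Hol :=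
  PowerSeries.C ((J γ ^ (-w) : Holˣ) : Hol) *
    PowerSeries.mk (fun n => ((n ! : ℂ)⁻¹) • (-K γ) ^ n) *
      PowerSeries.rescale ((J γ ^ (-2 : ℤ) : Holˣ) : Hol) (PowerSeries.map (pull γ) Φ)

/-- `(F ‖_w γ)(z, X) = J(γ,z)^{-w} F(γ z, J(γ,z)^2 (X - K(γ,z)))`. -/
def slashP (w : ℤ) (γ : SL(2, ℝ)) (F : Polynomial Hol) : Polynomial Hol :=
  Polynomial.C ((J γ ^ (-w) : Holˣ) : Hol) *
    (F.map (pull γ : Hol →+* Hol)).comp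
      (Polynomial.C ((J γ ^ (2 : ℤ) : Holˣ) : Hol) * (Polynomial.X - Polynomial.C (K γ)))

/-- The space of Jacobi-like forms for `Γ` of weight `w` that are divisible by `X ^ δ`. -/
def JForm (Γ : Subgroup SL(2, ℝ)) (w : ℤ) (δ : ℕ) : Set (PowerSeries Hol) :=
  {Φ | PowerSeries.X ^ δ ∣ Φ ∧ ∀ γ ∈ Γ, slashJ w γ Φ = Φ}

theorem smul_eq_C_mul_poly (c : ℂ) (F : Polynomial Hol) :
    c • F = Polynomial.C (algebraMap ℂ Hol c) * F := by
  rw [← Polynomial.smul_eq_C_mul, algebraMap_smul]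

/-- The space of quasimodular polynomials for `Γ` of weight `w` and degree at most `m`. -/
def QP (Γ : Subgroup SL(2, ℝ)) (m : ℕ) (w : ℤ) : Submodule ℂ (Polynomial Hol) where
  carrier := {F | F.natDegree ≤ m ∧ ∀ γ ∈ Γ, slashP w γ F = F}
  zero_mem' := ⟨by simp, fun γ _ => by simp [slashP]⟩
  add_mem' := by
    rintro F G ⟨hF, hF'⟩ ⟨hG, hG'⟩
    refine ⟨(Polynomial.natDegree_add_le F G).trans (max_le hF hG), fun γ hγ => ?_⟩
    have h : slashP w γ (F + G) = slashP w γ F + slashP w γ G := by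
      simp only [slashP, Polynomial.map_add, Polynomial.add_comp, mul_add]
    rw [h, hF' γ hγ, hG' γ hγ]
  smul_mem' := by
    rintro c F ⟨hF, hF'⟩
    refine ⟨(Polynomial.natDegree_smul_le c F).trans hF, fun γ hγ => ?_⟩
    have h : slashP w γ (c • F) = c • slashP w γ F := by
      have h1 : (pull γ : Hol →+* Hol) (algebraMap ℂ Hol c) = algebraMap ℂ Hol c :=
        (pull γ).commutes c
      simp only [slashP, smul_eq_C_mul_poly, Polynomial.map_mul, Polynomial.map_C, Polynomial.mul_comp,
        Polynomial.C_comp, h1]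
      ring
    rw [h, hF' γ hγ]

/-- The graded space `⨁_{ℓ ≥ 0} QP^m_ℓ(Γ)`. -/
abbrev QHat (Γ : Subgroup SL(2, ℝ)) (m : ℕ) : Type :=
  DirectSum ℕ fun ℓ => QP Γ m (ℓ : ℤ)

/-- The inclusion of the component of weight `ℓ` in the graded space. -/
abbrev comp (Γ : Subgroup SL(2, ℝ)) (m ℓ : ℕ) : QP Γ m (ℓ : ℤ) →ₗ[ℂ] QHat Γ m :=
  DirectSum.lof ℂ ℕ (fun ℓ => QP Γ m (ℓ : ℤ)) ℓ

/-- The map `Π^δ_m` with `Π^δ_m (∑ φ_k X^{k+δ}) = ∑_{r ≤ m} φ_{m-r} X^r / r!`. -/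
def PiJ (δ m : ℕ) (Φ : PowerSeries Hol) : Polynomial Hol :=
  ∑ r ∈ Finset.range (m + 1),
    Polynomial.monomial r (((r ! : ℂ)⁻¹) • PowerSeries.coeff (m - r + δ) Φ)

/-! ### The explicit brackets -/

/-- The constant
`(r-p+α)! (r-p+q+α-1)! (p-q+β)! (p-q+β-1)! / (q! (r+α+β)! (r+α+β-1)!)`,
meant for `q ≤ p ≤ r` and `α, β > 0`. -/
def Xi (α β r p q : ℕ) : ℂ :=
  (((r - p + α)! * (r - p + q + α - 1)! * (p - q + β)! * (p - q + β - 1)! : ℕ) : ℂ) /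
    ((q ! * (r + α + β)! * (r + α + β - 1)! : ℕ) : ℂ)

/-- The bracket `[F, G]^X` of `F = ∑ f_k X^{k+δ₁}` and `G = ∑ g_k X^{k+δ₂}`, where `F` and `G` are
given the weights `2 ξ₁` and `2 ξ₂`; meant for `δ₁ + ξ₁ > 0` and `δ₂ + ξ₂ > 0`. -/
def bracketX (δ₁ δ₂ : ℕ) (ξ₁ ξ₂ : ℤ) (F G : PowerSeries Hol) : PowerSeries Hol :=
  PowerSeries.X ^ (δ₁ + δ₂) * PowerSeries.mk fun r =>
    ∑ p ∈ Finset.range (r + 1), ∑ q ∈ Finset.range (p + 1),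
      (Xi (δ₁ + ξ₁).toNat (δ₂ + ξ₂).toNat r p q •
          (PowerSeries.coeff (r - p + δ₁) F * D^[q] (PowerSeries.coeff (p - q + δ₂) G)) -
        Xi (δ₂ + ξ₂).toNat (δ₁ + ξ₁).toNat r p q •
          (PowerSeries.coeff (r - p + δ₂) G * D^[q] (PowerSeries.coeff (p - q + δ₁) F)))

/-- The bracket `[F₁, F₂]^Q` of quasimodular polynomials of weights `2 ξ₁` and `2 ξ₂` and degree
at most `m`; meant for `ξ₁, ξ₂ > m`. -/
def bracketQ (m ξ₁ ξ₂ : ℕ) (F₁ F₂ : Polynomial Hol) : Polynomial Hol :=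
  ∑ r ∈ Finset.range (m + 1), Polynomial.monomial r
    (∑ p ∈ Finset.range (m - r + 1), ∑ q ∈ Finset.range (p + 1),
      ((((r + p)! * (m - p + q)! : ℕ) : ℂ) / (r ! : ℂ)) •
        (Xi (ξ₁ - m) (ξ₂ - m) (m - r) p q •
            (F₁.coeff (r + p) * D^[q] (F₂.coeff (m - p + q))) -
          Xi (ξ₂ - m) (ξ₁ - m) (m - r) p q •
            (F₂.coeff (r + p) * D^[q] (F₁.coeff (m - p + q)))))

/-! ### Pseudodifferential operators -/

/-- Pseudodifferential operators `∑_{k ≤ u} h_k ∂^k`, given by their coefficients. -/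
def PsiDOSubmodule : Submodule ℂ (ℤ → Hol) where
  carrier := {h | ∃ u : ℤ, ∀ k, u < k → h k = 0}
  zero_mem' := ⟨0, fun _ _ => rfl⟩
  add_mem' := by
    rintro a b ⟨u, hu⟩ ⟨v, hv⟩
    refine ⟨max u v, fun k hk => ?_⟩
    simp [hu k (lt_of_le_of_lt (le_max_left _ _) hk), hv k (lt_of_le_of_lt (le_max_right _ _) hk)]
  smul_mem' := by
    rintro c a ⟨u, hu⟩
    exact ⟨u, fun k hk => by simp [hu k hk]⟩

/-- The complex vector space of pseudodifferential operators. -/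
abbrev PsiDO : Type := PsiDOSubmodule

/-- The coefficient of `∂^k`. -/
def PsiDO.coeff (P : PsiDO) (k : ℤ) : Hol := P.1 k

/-- The operator has order at most `u`. -/
def PsiDO.OrderLE (u : ℤ) (P : PsiDO) : Prop := ∀ k, u < k → P.coeff k = 0

theorem D_zero : D 0 = 0 := by
  ext z
  have h : (((0 : Hol) : ℍ → ℂ) ∘ ofComplex) = fun _ : ℂ => (0 : ℂ) := rfl
  change deriv (((0 : Hol) : ℍ → ℂ) ∘ ofComplex) (z : ℂ) = 0
  rw [h]
  exact deriv_const _ _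

theorem D_iterate_zero (q : ℕ) : D^[q] 0 = 0 := Function.iterate_fixed D_zero q

/-- The coefficient of `∂^n` in the product of two operators, from the Leibniz rule
`∂^k g = ∑_q (k choose q) g^{(q)} ∂^{k-q}` for all integers `k`. -/
def PsiDO.mulCoeff (P Q : PsiDO) (n : ℤ) : Hol :=
  ∑ᶠ x : ℤ × ℕ, (Ring.choose x.1 x.2 : ℤ) • (P.coeff x.1 * D^[x.2] (Q.coeff (n - x.1 + x.2)))

theorem PsiDO.mulCoeff_eq_zero {P Q : PsiDO} {u v : ℤ} (hP : P.OrderLE u) (hQ : Q.OrderLE v)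
    {n : ℤ} (hn : u + v < n) : P.mulCoeff Q n = 0 := by
  refine finsum_eq_zero_of_forall_eq_zero fun x => ?_
  by_cases h : u < x.1
  · rw [hP _ h, zero_mul, smul_zero]
  · rw [hQ _ (by omega), D_iterate_zero, mul_zero, smul_zero]

/-- The product of pseudodifferential operators. -/
def PsiDO.mul (P Q : PsiDO) : PsiDO :=
  ⟨P.mulCoeff Q, by
    obtain ⟨u, hu⟩ := P.2
    obtain ⟨v, hv⟩ := Q.2
    exact ⟨u + v, fun _ hn => PsiDO.mulCoeff_eq_zero hu hv hn⟩⟩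

/-- The commutator of pseudodifferential operators. -/
def PsiDO.commutator (P Q : PsiDO) : PsiDO := P.mul Q - Q.mul P

/-- The operator `h ∂^k`. -/
def PsiDO.single (h : Hol) (k : ℤ) : PsiDO :=
  ⟨fun n => if n = k then h else 0, k, fun _ hn => if_neg (ne_of_gt hn)⟩

/-- Powers with a natural exponent. -/
def PsiDO.npow (P : PsiDO) : ℕ → PsiDO
  | 0 => PsiDO.single 1 0
  | n + 1 => (PsiDO.npow P n).mul P

/-- The powers `(J(γ,z)^2 ∂)^k` for an integer `k`; the inverse of `J^2 ∂` is `∂^{-1} J^{-2}`. -/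
def PsiDO.transformedPow (γ : SL(2, ℝ)) : ℤ → PsiDO
  | Int.ofNat n => (PsiDO.single ((J γ ^ (2 : ℤ) : Holˣ) : Hol) 1).npow n
  | Int.negSucc n =>
      ((PsiDO.single 1 (-1)).mul
        (PsiDO.single ((J γ ^ (-2 : ℤ) : Holˣ) : Hol) 0)).npow (n + 1)

theorem PsiDO.orderLE_single (h : Hol) (k : ℤ) : (PsiDO.single h k).OrderLE k :=
  fun _ hn => if_neg (ne_of_gt hn)

theorem PsiDO.OrderLE.mul {P Q : PsiDO} {u v : ℤ} (hP : P.OrderLE u) (hQ : Q.OrderLE v) :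
    (P.mul Q).OrderLE (u + v) :=
  fun _ hn => PsiDO.mulCoeff_eq_zero hP hQ hn

theorem PsiDO.OrderLE.npow {P : PsiDO} {u : ℤ} (hP : P.OrderLE u) (n : ℕ) :
    (P.npow n).OrderLE (n * u) := by
  induction n with
  | zero => simpa [PsiDO.npow] using PsiDO.orderLE_single 1 0
  | succ n ih =>
    have h := ih.mul hP
    rw [show ((n + 1 : ℕ) : ℤ) * u = n * u + u by push_cast; ring]
    exact h

theorem PsiDO.orderLE_transformedPow (γ : SL(2, ℝ)) (k : ℤ) :
    (PsiDO.transformedPow γ k).OrderLE k := by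
  cases k with
  | ofNat n =>
    have h := (PsiDO.orderLE_single ((J γ ^ (2 : ℤ) : Holˣ) : Hol) 1).npow n
    rw [mul_one] at h
    exact h
  | negSucc n =>
    have h := (((PsiDO.orderLE_single 1 (-1)).mul
      (PsiDO.orderLE_single ((J γ ^ (-2 : ℤ) : Holˣ) : Hol) 0))).npow (n + 1)
    rw [show ((n + 1 : ℕ) : ℤ) * (-1 + 0) = Int.negSucc n by
      rw [Int.negSucc_eq]; push_cast; ring] at h
    exact h

/-- `(Ψ ∘ γ)(z) = ∑_k h_k(γ z) (J(γ,z)^2 ∂)^k`; in each degree the sum over `k` is finite. -/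
def PsiDO.slash (P : PsiDO) (γ : SL(2, ℝ)) : PsiDO :=
  ⟨fun n => ∑ᶠ k : ℤ, pull γ (P.coeff k) * (PsiDO.transformedPow γ k).coeff n, by
    obtain ⟨u, hu⟩ := P.2
    refine ⟨u, fun n hn => finsum_eq_zero_of_forall_eq_zero fun k => ?_⟩
    by_cases h : u < k
    · rw [show P.coeff k = 0 from hu k h, map_zero, zero_mul]
    · rw [PsiDO.orderLE_transformedPow γ k n (by omega), mul_zero]⟩

/-- The automorphic pseudodifferential operators for `Γ` of order at most `a`. -/
def AutPsiDO (Γ : Subgroup SL(2, ℝ)) (a : ℤ) : Set PsiDO :=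
  {P | P.OrderLE a ∧ ∀ γ ∈ Γ, P.slash γ = P}

/-- `C_η = (-1)^η η! (η-1)!`, meant for `η > 0`. -/
def Cst (η : ℤ) : ℂ := (-1) ^ η.toNat * ((η.toNat ! * (η.toNat - 1)! : ℕ) : ℂ)

/-- The map `I^∂_ξ` with `I^∂_ξ (∑_{k ≥ 0} f_k X^{k+δ}) = ∑_{k ≥ 0} C_{k+δ+ξ} f_k ∂^{-k-δ-ξ}`,
meant for `δ + ξ > 0`: the monomial `X^j` goes to `C_{j+ξ} ∂^{-(j+ξ)}`. -/
def toPsiDO (ξ : ℤ) (F : PowerSeries Hol) : PsiDO :=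
  ⟨fun n => if 0 ≤ -n - ξ then Cst (-n) • PowerSeries.coeff (-n - ξ).toNat F else 0,
    -ξ, fun n hn => if_neg (by omega)⟩

/-- The map `^∂Π^{-ε}_m` with
`^∂Π^{-ε}_m (∑ ψ_k ∂^{-k-ε}) = ∑_{r ≤ m} ψ_{m-r} X^r / (r! C_{m-r+ε})`. -/
def PiPsi (ε : ℤ) (m : ℕ) (P : PsiDO) : Polynomial Hol :=
  ∑ r ∈ Finset.range (m + 1), Polynomial.monomial r
    (((r ! : ℂ) * Cst ((m - r : ℕ) + ε))⁻¹ • P.coeff (-((m - r : ℕ) : ℤ) - ε))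

end QuasiLie

end

/-!
The proof rests on the ring of pseudodifferential operators, of which all the brackets are shadows.

*The ring.* Multiplication is associative: an additive map that respects the order filtration is
determined by its values on the operators `h ∂^k` (`PsiDO.map_eq_zero_of_single`). This reduces
associativity to left factors `∂^k`, hence, as left multiplication by `∂` is injective, to `∂`
itself, where it is Pascal's rule together with the product rule (`PsiDO.del_mul_assoc`). So the
commutator satisfies the Jacobi identity.

*The action.* By the chain rule `J² ∂` satisfies the Leibniz rule on the functions `f(γ z)` that
`∂` satisfies on the functions `f(z)` (`PsiDO.twistedDel_mul_pull`), and the same density argument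
shows that the action of `γ` on operators is multiplicative (`PsiDO.slash_mul`). It therefore
respects commutators.

*Coordinates.* For `n > 0` the expansion
`(J² ∂)^{-n} = J^{-2n} ∑_i (n+i)! (n+i-1)! / (n! (n-1)! i!) K^i ∂^{-n-i}` follows by induction from a
two-term recursion, and it says precisely that `toPsiDO` intertwines the action on Jacobi-like forms
with the action on operators (`toPsiDO_slashJ`). Comparing coefficients, `toPsiDO` carries
`bracketX` to the commutator (`toPsiDO_bracketX`), and the projections to polynomials intertwine the
actions (`PiJ_slashJ`) and carry `bracketX` to `bracketQ` (`PiJ_bracketX_zero`).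

*Conclusion.* Every polynomial of degree at most `m` lifts to an operator, not necessarily an
automorphic one. As the projection of a commutator only depends on the projections of its two
entries (`PiPsi_lie`) and is equivariant (`PiPsi_slash`), the bracket of quasimodular polynomials is
again quasimodular (`slashP_bracketQ`) and satisfies the Jacobi identity (`bracketQ_jacobi`),
although a quasimodular polynomial need not be known to lift to an automorphic operator.
-/

noncomputable section

namespace QuasiLie

open UpperHalfPlane

/-! ### Differential calculus on the upper half plane -/

theorem hasDerivAt_ofComplex (f : Hol) (z : ℍ) :
    HasDerivAt ((f : ℍ → ℂ) ∘ ofComplex) ((D f : ℍ → ℂ) z) (z : ℂ) :=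
  (UpperHalfPlane.mdifferentiableAt_iff.mp (f.2 z)).hasDerivAt

theorem D_eq_of_hasDerivAt {f : Hol} {g : Hol}
    (h : ∀ z : ℍ, HasDerivAt ((f : ℍ → ℂ) ∘ ofComplex) ((g : ℍ → ℂ) z) (z : ℂ)) : D f = g := by
  ext z
  exact (h z).deriv

theorem D_add (f g : Hol) : D (f + g) = D f + D g :=
  D_eq_of_hasDerivAt fun z => (hasDerivAt_ofComplex f z).add (hasDerivAt_ofComplex g z)

theorem D_mul (f g : Hol) : D (f * g) = D f * g + f * D g := by
  refine D_eq_of_hasDerivAt fun z => ?_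
  have h := (hasDerivAt_ofComplex f z).mul (hasDerivAt_ofComplex g z)
  simp only [Function.comp_apply, ofComplex_apply] at h
  exact h

theorem D_smul (c : ℂ) (f : Hol) : D (c • f) = c • D f :=
  D_eq_of_hasDerivAt fun z => (hasDerivAt_ofComplex f z).const_smul c

/-- The derivative `d/dz` as a linear map. -/
def DLin : Hol →ₗ[ℂ] Hol where
  toFun := D
  map_add' := D_add
  map_smul' := D_smul

theorem D_iterate_eq (q : ℕ) (f : Hol) : D^[q] f = (DLin ^ q) f :=
  (Module.End.pow_apply DLin q f).symm

theorem D_one : D 1 = 0 := by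
  have h := D_mul 1 1
  simpa using h

theorem D_iterate_one {q : ℕ} (hq : q ≠ 0) : D^[q] 1 = 0 := by
  obtain ⟨q, rfl⟩ := Nat.exists_eq_succ_of_ne_zero hq
  rw [Function.iterate_succ_apply, D_one, D_iterate_zero]

theorem K_mul_J (γ : SL(2, ℝ)) : K γ * (J γ : Hol) = ((γ 1 0 : ℝ) : ℂ) • (1 : Hol) := by
  rw [K, smul_mul_assoc, Units.inv_mul]

theorem D_J (γ : SL(2, ℝ)) : D (J γ : Hol) = K γ * (J γ : Hol) := by
  rw [K_mul_J]
  refine D_eq_of_hasDerivAt fun z => ?_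
  have h := hasDerivAt_denom_zpow (γ : GL (Fin 2) ℝ) 1 z
  simp only [zpow_one, Int.cast_one, one_mul, sub_self, zpow_zero] at h
  refine (h.congr_of_eventuallyEq ?_).congr_deriv ?_
  · filter_upwards [isOpen_upperHalfPlaneSet.mem_nhds z.im_pos] with w hw
    change denom γ (ofComplex w : ℂ) = _
    rw [ofComplex_apply_of_im_pos hw]
  · change _ = ((γ 1 0 : ℝ) : ℂ) * 1
    rfl

theorem D_inv_unit (u : Holˣ) : D ((u⁻¹ : Holˣ) : Hol) = -(D u * ((u⁻¹ : Holˣ) : Hol) ^ 2) := by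
  have h := D_mul (u : Hol) ((u⁻¹ : Holˣ) : Hol)
  rw [Units.mul_inv, D_one] at h
  have h2 : ((u⁻¹ : Holˣ) : Hol) * u = 1 := Units.inv_mul u
  linear_combination (-((u⁻¹ : Holˣ) : Hol)) * h -  D ((u⁻¹ : Holˣ) : Hol) * h2

theorem D_K (γ : SL(2, ℝ)) : D (K γ) = -K γ ^ 2 := by
  have h := congrArg D (K_mul_J γ)
  rw [D_mul, D_smul, D_one, smul_zero, D_J] at h
  have h2 : (J γ : Hol) * (((J γ)⁻¹ : Holˣ) : Hol) = 1 := Units.mul_inv _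
  linear_combination (((J γ)⁻¹ : Holˣ) : Hol) * h - (D (K γ) + K γ ^ 2) * h2

theorem D_J_zpow (γ : SL(2, ℝ)) (n : ℤ) :
    D ((J γ ^ n : Holˣ) : Hol) = (n : Hol) * K γ * ((J γ ^ n : Holˣ) : Hol) := by
  induction n with
  | zero => simp [D_one]
  | succ n ih =>
    rw [zpow_add_one, Units.val_mul, D_mul, ih, D_J]
    push_cast
    ring
  | pred n ih =>
    rw [zpow_sub_one, Units.val_mul, D_mul, ih, D_inv_unit, D_J]
    have h2 : (((J γ)⁻¹ : Holˣ) : Hol) * J γ = 1 := Units.inv_mul _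
    push_cast
    linear_combination (-(K γ * ((J γ ^ (-n : ℤ) : Holˣ) : Hol) * ((J γ)⁻¹ : Holˣ))) * h2

theorem D_K_pow (γ : SL(2, ℝ)) (n : ℕ) : D (K γ ^ n) = -(n : Hol) * K γ ^ (n + 1) := by
  induction n with
  | zero => simp [D_one]
  | succ n ih =>
    rw [pow_succ, D_mul, ih, D_K]
    push_cast
    ring

/-- The chain rule for a Möbius transformation. -/
theorem D_pull (γ : SL(2, ℝ)) (f : Hol) :
    D (pull γ f) = ((J γ ^ (-2 : ℤ) : Holˣ) : Hol) * pull γ (D f) := by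
  refine D_eq_of_hasDerivAt fun z => ?_
  have hdet : (γ : GL (Fin 2) ℝ).val.det = 1 := by
    rw [← Matrix.GeneralLinearGroup.val_det_apply]; simp
  have h := (hasStrictDerivAt_smul (g := (γ : GL (Fin 2) ℝ)) (by rw [hdet]; exact one_pos)
    z).hasDerivAt
  have h2 : HasDerivAt ((f : ℍ → ℂ) ∘ ofComplex) ((D f : ℍ → ℂ) (γ • z))
      (((γ : GL (Fin 2) ℝ) • ofComplex (z : ℂ) : ℍ) : ℂ) := by
    rw [ofComplex_apply]
    exact hasDerivAt_ofComplex f (γ • z)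
  have h3 := h2.comp (z : ℂ) h
  refine (h3.congr_of_eventuallyEq ?_).congr_deriv ?_
  · refine Filter.Eventually.of_forall fun w => ?_
    change (f : ℍ → ℂ) _ = (f : ℍ → ℂ) _
    rw [ofComplex_apply]
    rfl
  · rw [hdet, zpow_neg, Complex.ofReal_one, one_div, mul_comm]
    have h4 : (((J γ ^ (2 : ℤ))⁻¹ : Holˣ) : Hol) = (((J γ)⁻¹ : Holˣ) : Hol) ^ 2 := by
      rw [← Units.val_pow_eq_pow_val, inv_pow]; rfl
    rw [h4]
    change _ = ((denom γ z)⁻¹ ^ 2) * _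
    rw [inv_pow]
    rfl

/-! ### The ring of pseudodifferential operators -/

namespace PsiDO

@[ext]
theorem ext_coeff {P Q : PsiDO} (h : ∀ n, P.coeff n = Q.coeff n) : P = Q :=
  Subtype.ext (funext h)

@[simp] theorem coeff_add (P Q : PsiDO) (n : ℤ) : (P + Q).coeff n = P.coeff n + Q.coeff n := rfl

@[simp] theorem coeff_sub (P Q : PsiDO) (n : ℤ) : (P - Q).coeff n = P.coeff n - Q.coeff n := rfl

@[simp] theorem coeff_zero (n : ℤ) : (0 : PsiDO).coeff n = 0 := rfl

theorem coeff_single (h : Hol) (k n : ℤ) : (single h k).coeff n = if n = k then h else 0 := rfl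

theorem OrderLE.mono {P : PsiDO} {u v : ℤ} (h : P.OrderLE u) (huv : u ≤ v) : P.OrderLE v :=
  fun k hk => h k (huv.trans_lt hk)

theorem OrderLE.sub {P Q : PsiDO} {u : ℤ} (hP : P.OrderLE u) (hQ : Q.OrderLE u) :
    (P - Q).OrderLE u := fun k hk => by rw [coeff_sub, hP k hk, hQ k hk, sub_zero]

theorem OrderLE.add {P Q : PsiDO} {u : ℤ} (hP : P.OrderLE u) (hQ : Q.OrderLE u) :
    (P + Q).OrderLE u := fun k hk => by rw [coeff_add, hP k hk, hQ k hk, add_zero]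

/-- An additive map that shifts orders by a bounded amount vanishes as soon as it kills all
`h ∂^k`: the operators of finite length are dense for the order filtration. -/
theorem map_eq_zero_of_single {Φ : PsiDO →+ PsiDO} {v : ℤ}
    (hΦ : ∀ u (P : PsiDO), P.OrderLE u → (Φ P).OrderLE (u + v))
    (h0 : ∀ h k, Φ (single h k) = 0) (P : PsiDO) : Φ P = 0 := by
  obtain ⟨u, hu⟩ := P.2
  have key : ∀ N : ℕ, ∃ P' : PsiDO, P'.OrderLE (u - N) ∧ Φ P = Φ P' := by
    intro N
    induction N with
    | zero => exact ⟨P, OrderLE.mono (u := u) hu (by simp), rfl⟩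
    | succ N ih =>
      obtain ⟨P', h1, h2⟩ := ih
      refine ⟨P' - single (P'.coeff (u - N)) (u - N), fun k hk => ?_, by
        rw [h2]; exact ((map_sub Φ _ _).trans (by rw [h0]; exact sub_zero (Φ P'))).symm⟩
      rw [coeff_sub, coeff_single]
      split_ifs with hkN
      · rw [hkN, sub_self]
      · rw [h1 k (by push_cast at hk; omega), sub_zero]
  ext1 n
  obtain ⟨P', h1, h2⟩ := key (u + v - n + 1).toNat
  rw [h2]
  exact hΦ _ _ h1 n (by omega)

/-- The product as a finite sum, over any sufficiently large rectangle of indices. -/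
theorem mulCoeff_eq_sum {P Q : PsiDO} {u v : ℤ} (hP : P.OrderLE u) (hQ : Q.OrderLE v) {n : ℤ}
    {M N : ℕ} (hM : u + v - n < M) (hN : u + v - n < N) :
    P.mulCoeff Q n = ∑ i ∈ Finset.range M, ∑ q ∈ Finset.range N,
      (Ring.choose (u - i) q : ℤ) • (P.coeff (u - i) * D^[q] (Q.coeff (n - (u - i) + q))) := by
  rw [mulCoeff, ← Finset.sum_product']
  let e : ℕ × ℕ ↪ ℤ × ℕ := ⟨fun x => (u - x.1, x.2), fun x y h => by
    simp only [Prod.mk.injEq] at h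
    exact Prod.ext (by omega) h.2⟩
  rw [finsum_eq_sum_of_support_subset (s := (Finset.range M ×ˢ Finset.range N).map e),
    Finset.sum_map]
  · rfl
  · intro x hx
    have h1 : x.1 ≤ u := by
      by_contra h
      exact hx (by simp only [hP _ (not_le.mp h), zero_mul, smul_zero])
    have h2 : n - x.1 + x.2 ≤ v := by
      by_contra h
      exact hx (by simp only [hQ _ (not_le.mp h), D_iterate_zero, mul_zero, smul_zero])
    simp only [Finset.coe_map, Set.mem_image, Finset.mem_coe, Finset.mem_product,
      Finset.mem_range]
    refine ⟨((u - x.1).toNat, x.2), ⟨?_, ?_⟩, Prod.ext ?_ rfl⟩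
    · dsimp only; omega
    · dsimp only; omega
    · change u - ((u - x.1).toNat : ℤ) = x.1; omega

theorem exists_orderLE (P : PsiDO) : ∃ u, P.OrderLE u := P.2

theorem D_iterate_add (q : ℕ) (f g : Hol) : D^[q] (f + g) = D^[q] f + D^[q] g := by
  simp only [D_iterate_eq, map_add]

theorem add_mul' (P P' Q : PsiDO) : (P + P').mul Q = P.mul Q + P'.mul Q := by
  obtain ⟨u, hu⟩ := P.exists_orderLE
  obtain ⟨u', hu'⟩ := P'.exists_orderLE
  obtain ⟨v, hv⟩ := Q.exists_orderLE
  have h1 := hu.mono (le_max_left u u')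
  have h2 := hu'.mono (le_max_right u u')
  ext1 n
  change mulCoeff _ _ _ = mulCoeff _ _ _ + mulCoeff _ _ _
  have hN : max u u' + v - n < ((max u u' + v - n).toNat + 1 : ℕ) := by omega
  rw [mulCoeff_eq_sum (h1.add h2) hv hN hN, mulCoeff_eq_sum h1 hv hN hN,
    mulCoeff_eq_sum h2 hv hN hN]
  simp only [coeff_add, add_mul, smul_add, Finset.sum_add_distrib]

theorem mul_add' (P Q Q' : PsiDO) : P.mul (Q + Q') = P.mul Q + P.mul Q' := by
  obtain ⟨u, hu⟩ := P.exists_orderLE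
  obtain ⟨v, hv⟩ := Q.exists_orderLE
  obtain ⟨v', hv'⟩ := Q'.exists_orderLE
  have h1 := hv.mono (le_max_left v v')
  have h2 := hv'.mono (le_max_right v v')
  ext1 n
  change mulCoeff _ _ _ = mulCoeff _ _ _ + mulCoeff _ _ _
  have hN : u + max v v' - n < ((u + max v v' - n).toNat + 1 : ℕ) := by omega
  rw [mulCoeff_eq_sum hu (h1.add h2) hN hN, mulCoeff_eq_sum hu h1 hN hN,
    mulCoeff_eq_sum hu h2 hN hN]
  simp only [coeff_add, D_iterate_add, mul_add, smul_add, Finset.sum_add_distrib]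

theorem coeff_single_mul (g : Hol) (k : ℤ) {Q : PsiDO} {v : ℤ} (hQ : Q.OrderLE v) {n : ℤ} {N : ℕ}
    (hN : k + v - n < N) : ((single g k).mul Q).coeff n =
      ∑ q ∈ Finset.range N, (Ring.choose k q : ℤ) • (g * D^[q] (Q.coeff (n - k + q))) := by
  change mulCoeff _ _ _ = _
  rw [mulCoeff_eq_sum (M := N + 1) (orderLE_single g k) hQ (by push_cast; omega) hN,
    Finset.sum_range_succ', Finset.sum_eq_zero, zero_add]
  · simp [coeff_single]
  · intro i _
    refine Finset.sum_eq_zero fun q _ => ?_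
    rw [coeff_single, if_neg (by push_cast; omega), zero_mul, smul_zero]

theorem coeff_single_zero_mul (g : Hol) (Q : PsiDO) (n : ℤ) :
    ((single g 0).mul Q).coeff n = g * Q.coeff n := by
  obtain ⟨v, hv⟩ := Q.exists_orderLE
  rw [coeff_single_mul (N := (v - n).toNat + 1) g 0 hv (by omega), Finset.sum_range_succ',
    Finset.sum_eq_zero]
  · simp
  · intro q _
    rw [Ring.choose_zero_succ, zero_smul]

theorem coeff_single_one_mul (g : Hol) (Q : PsiDO) (n : ℤ) :
    ((single g 1).mul Q).coeff n = g * (Q.coeff (n - 1) + D (Q.coeff n)) := by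
  obtain ⟨v, hv⟩ := Q.exists_orderLE
  rw [coeff_single_mul (N := (v - n).toNat + 3) g 1 hv (by omega), Finset.sum_range_succ',
    Finset.sum_range_succ', Finset.sum_eq_zero]
  · simp
    ring
  · intro q _
    have h : Ring.choose (1 : ℤ) (q + 1 + 1) = 0 := by
      have := Ring.choose_natCast (R := ℤ) 1 (q + 1 + 1)
      rw [Nat.choose_eq_zero_of_lt (by omega)] at this
      simpa using this
    rw [h, zero_smul]

/-- Factorization of left multiplication by `g ∂^k`. -/
theorem single_mul_eq (g : Hol) (k : ℤ) (Q : PsiDO) :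
    (single g k).mul Q = (single g 0).mul ((single 1 k).mul Q) := by
  obtain ⟨v, hv⟩ := Q.exists_orderLE
  ext1 n
  have hN : k + v - n < ((k + v - n).toNat + 1 : ℕ) := by omega
  rw [coeff_single_zero_mul, coeff_single_mul g k hv hN, coeff_single_mul 1 k hv hN,
    Finset.mul_sum]
  refine Finset.sum_congr rfl fun q _ => ?_
  rw [one_mul, mul_smul_comm]

theorem single_zero_mul_assoc (g : Hol) (Q R : PsiDO) :
    (single g 0).mul (Q.mul R) = ((single g 0).mul Q).mul R := by
  obtain ⟨u, hu⟩ := Q.exists_orderLE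
  obtain ⟨v, hv⟩ := R.exists_orderLE
  ext1 n
  have hN : u + v - n < ((u + v - n).toNat + 1 : ℕ) := by omega
  have h1 : ((single g 0).mul Q).OrderLE u := fun k hk => by
    rw [coeff_single_zero_mul, hu k hk, mul_zero]
  rw [coeff_single_zero_mul]
  change g * mulCoeff _ _ _ = mulCoeff _ _ _
  rw [mulCoeff_eq_sum hu hv hN hN, mulCoeff_eq_sum h1 hv hN hN, Finset.mul_sum]
  refine Finset.sum_congr rfl fun i _ => ?_
  rw [Finset.mul_sum]
  refine Finset.sum_congr rfl fun q _ => ?_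
  rw [coeff_single_zero_mul, mul_smul_comm, mul_assoc]

/-- Composition with `∂` is associative; this is Pascal's rule for the generalized binomial
coefficients. -/
theorem del_mul_assoc (Q R : PsiDO) :
    (single 1 1).mul (Q.mul R) = ((single 1 1).mul Q).mul R := by
  obtain ⟨u, hu⟩ := Q.exists_orderLE
  obtain ⟨v, hv⟩ := R.exists_orderLE
  have hA : ∀ k, u + 1 < k → Q.coeff (k - 1) = 0 := fun k hk => hu _ (by omega)
  have hB : ∀ k, u < k → D (Q.coeff k) = 0 := fun k hk => by rw [hu k hk, D_zero]
  -- `∂ Q = Q ∂ + Q'`, where `A` is `Q ∂` and `B` is `Q'`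
  let A : PsiDO := ⟨fun k => Q.coeff (k - 1), u + 1, hA⟩
  let B : PsiDO := ⟨fun k => D (Q.coeff k), u, hB⟩
  have hAB : (single 1 1).mul Q = A + B := by
    ext1 n
    rw [coeff_single_one_mul, one_mul]
    rfl
  rw [hAB, add_mul']
  ext1 n
  rw [coeff_single_one_mul, one_mul]
  change mulCoeff _ _ _ + D (mulCoeff _ _ _) = mulCoeff _ _ _ + mulCoeff _ _ _
  obtain ⟨N, hN⟩ : ∃ N : ℕ, u + v - n < N := ⟨(u + v - n + 1).toNat, by omega⟩
  rw [mulCoeff_eq_sum (M := N + 1) (N := N + 1) hu hv (by push_cast; omega) (by push_cast; omega),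
    mulCoeff_eq_sum (M := N + 1) (N := N) hu hv (by push_cast; omega) hN,
    mulCoeff_eq_sum (M := N + 1) (N := N + 1) (P := A) hA hv (by push_cast; omega)
      (by push_cast; omega),
    mulCoeff_eq_sum (M := N + 1) (N := N) (P := B) hB hv (by push_cast; omega) hN]
  have hD : ∀ (f : ℕ → ℕ → Hol), D (∑ i ∈ Finset.range (N + 1), ∑ q ∈ Finset.range N, f i q) =
      ∑ i ∈ Finset.range (N + 1), ∑ q ∈ Finset.range N, D (f i q) := fun f => by
    change DLin _ = _
    simp only [map_sum]
    rfl
  have hDz : ∀ (c : ℤ) (f : Hol), D (c • f) = c • D f := fun c f => map_zsmul DLin c f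
  rw [hD, ← Finset.sum_add_distrib, ← Finset.sum_add_distrib]
  refine Finset.sum_congr rfl fun i _ => ?_
  have h1 : ∀ q : ℕ, n - (u - i) + q = n - 1 - (u - i) + (q + 1 : ℕ) := fun q => by
    push_cast; ring
  have h2 : ∀ q : ℕ, n - (u + 1 - i) + q = n - 1 - (u - i) + q := fun q => by ring
  have h3 : A.coeff (u + 1 - i) = Q.coeff (u - i) := congrArg Q.coeff (by ring)
  have h4 : B.coeff (u - i) = D (Q.coeff (u - i)) := rfl
  have h5 : u + 1 - (i : ℤ) = u - i + 1 := by ring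
  simp only [hDz, D_mul, smul_add, Finset.sum_add_distrib, h2, h3, h4, h1,
    ← Function.iterate_succ_apply' D]
  -- splitting off `q = 0` leaves the coefficients `choose (k + 1) (q + 1)` of Pascal's rule
  rw [h5, Finset.sum_range_succ', Finset.sum_range_succ' _ N]
  simp only [Ring.choose_succ_succ, add_smul, Finset.sum_add_distrib, Ring.choose_zero_right]
  abel

/-- Left multiplication by `∂` is injective: a nonzero leading term of `X` gives a nonzero leading
term of `∂ X`, one order higher. -/
theorem del_mul_injective {X Y : PsiDO} (h : (single 1 1).mul X = (single 1 1).mul Y) :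
    X = Y := by
  obtain ⟨u, hu⟩ := X.exists_orderLE
  obtain ⟨v, hv⟩ := Y.exists_orderLE
  have hXY := (hu.mono (le_max_left u v)).sub (hv.mono (le_max_right u v))
  have key : ∀ N : ℕ, (X - Y).OrderLE (max u v - N) := by
    intro N
    induction N with
    | zero => simpa using hXY
    | succ N ih =>
      intro k hk
      have h1 := congrArg (coeff · (k + 1)) h
      simp only [coeff_single_one_mul, one_mul, add_sub_cancel_right] at h1
      have h2 := ih (k + 1) (by push_cast at hk; omega)
      rw [coeff_sub, sub_eq_zero] at h2
      rw [h2] at h1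
      rw [coeff_sub, add_right_cancel h1, sub_self]
  ext1 n
  have h2 := key (max u v - n + 1).toNat n (by omega)
  rwa [coeff_sub, sub_eq_zero] at h2

theorem del_mul_single (h : Hol) (k : ℤ) :
    (single 1 1).mul (single h k) = single h (k + 1) + single (D h) k := by
  ext1 n
  rw [coeff_single_one_mul, one_mul, coeff_add]
  simp only [coeff_single]
  congr 1
  · simp only [sub_eq_iff_eq_add]
  · split_ifs
    · rfl
    · exact D_zero

theorem single_zero_left (k : ℤ) : single 0 k = 0 := by
  ext1 n
  rw [coeff_single, ite_self, coeff_zero]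

theorem del_mul_del_pow (k : ℤ) : (single 1 1).mul (single 1 k) = single 1 (k + 1) := by
  rw [del_mul_single, D_one, single_zero_left, add_zero]

theorem single_one_zero_mul (P : PsiDO) : (single 1 0).mul P = P := by
  ext1 n
  rw [coeff_single_zero_mul, one_mul]

/-- Associativity spreads from `∂` to all powers of `∂`, upwards by multiplying with `∂` and
downwards by cancelling it. -/
theorem del_pow_mul_assoc (k : ℤ) (Q R : PsiDO) :
    (single 1 k).mul (Q.mul R) = ((single 1 k).mul Q).mul R := by
  induction k with
  | zero => rw [single_one_zero_mul, single_one_zero_mul]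
  | succ k ih =>
    simp only [← del_mul_del_pow (k : ℤ), ← del_mul_assoc, ih]
  | pred k ih =>
    apply del_mul_injective
    rw [del_mul_assoc, del_mul_assoc, del_mul_assoc, del_mul_del_pow, sub_add_cancel, ih]

theorem single_mul_assoc (g : Hol) (k : ℤ) (Q R : PsiDO) :
    (single g k).mul (Q.mul R) = ((single g k).mul Q).mul R := by
  rw [single_mul_eq, del_pow_mul_assoc, single_zero_mul_assoc, ← single_mul_eq]

theorem mul_single_one_zero (P : PsiDO) : P.mul (single 1 0) = P := by
  let Φ : PsiDO →+ PsiDO :=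
    AddMonoidHom.mk' (fun P => P.mul (single 1 0) - P) fun P Q => by rw [add_mul']; abel
  refine sub_eq_zero.mp (map_eq_zero_of_single (Φ := Φ) (v := 0) (fun u P hP => ?_)
    (fun h k => ?_) P)
  · exact (hP.mul (orderLE_single 1 0)).sub (hP.mono (by omega))
  · refine sub_eq_zero.mpr (?_ : (single h k).mul (single 1 0) = single h k)
    ext1 n
    obtain ⟨N, hN⟩ : ∃ N : ℕ, k + 0 - n < N := ⟨(k - n + 1).toNat, by omega⟩
    rw [coeff_single_mul (N := N + 1) h k (orderLE_single 1 0) (by push_cast; omega),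
      Finset.sum_range_succ', Finset.sum_eq_zero]
    · simp only [coeff_single, Ring.choose_zero_right, Function.iterate_zero_apply, one_smul,
        Nat.cast_zero, add_zero, zero_add, sub_eq_zero, mul_ite, mul_one, mul_zero]
    · intro q _
      rw [coeff_single]
      split_ifs
      · rw [D_iterate_one q.succ_ne_zero, mul_zero, smul_zero]
      · rw [D_iterate_zero, mul_zero, smul_zero]

protected theorem mul_assoc' (P Q R : PsiDO) : P.mul (Q.mul R) = (P.mul Q).mul R := by
  obtain ⟨v, hv⟩ := Q.exists_orderLE
  obtain ⟨w, hw⟩ := R.exists_orderLE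
  let Φ : PsiDO →+ PsiDO :=
    AddMonoidHom.mk' (fun P => P.mul (Q.mul R) - (P.mul Q).mul R) fun P P' => by
      simp only [add_mul']; abel
  refine sub_eq_zero.mp (map_eq_zero_of_single (Φ := Φ) (v := v + w) (fun u P hP => ?_)
    (fun h k => ?_) P)
  · exact (hP.mul (hv.mul hw)).sub (((hP.mul hv).mul hw).mono (by omega))
  · exact sub_eq_zero.mpr (single_mul_assoc h k Q R)

/-- The ring of pseudodifferential operators, with the multiplication `PsiDO.mul`. -/
instance : Ring PsiDO where
  __ := (inferInstance : AddCommGroup PsiDO)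
  mul := PsiDO.mul
  one := single 1 0
  left_distrib := mul_add'
  right_distrib := add_mul'
  zero_mul P := by
    have h := add_mul' 0 0 P
    rw [add_zero] at h
    exact left_eq_add.mp h
  mul_zero P := by
    have h := mul_add' P 0 0
    rw [add_zero] at h
    exact left_eq_add.mp h
  mul_assoc P Q R := (PsiDO.mul_assoc' P Q R).symm
  one_mul := single_one_zero_mul
  mul_one := mul_single_one_zero

theorem mul_def (P Q : PsiDO) : P.mul Q = P * Q := rfl

theorem one_def : (1 : PsiDO) = single 1 0 := rfl

theorem npow_eq_pow (P : PsiDO) (n : ℕ) : P.npow n = P ^ n := by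
  induction n with
  | zero => rfl
  | succ n ih => rw [npow, ih, pow_succ, mul_def]

theorem jacobi (P Q S : PsiDO) : ⁅P, ⁅Q, S⁆⁆ + ⁅Q, ⁅S, P⁆⁆ + ⁅S, ⁅P, Q⁆⁆ = 0 := by
  let _ : LieRing PsiDO := LieRing.ofAssociativeRing
  exact lie_jacobi P Q S

theorem OrderLE.lie {P Q : PsiDO} {u v : ℤ} (hP : P.OrderLE u) (hQ : Q.OrderLE v) :
    (⁅P, Q⁆ : PsiDO).OrderLE (u + v) :=
  (hP.mul hQ).sub ((hQ.mul hP).mono (by omega))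

end PsiDO

/-! ### The action of `SL(2, ℝ)` on pseudodifferential operators -/

namespace PsiDO

theorem single_zero_mul_single (g h : Hol) (k : ℤ) :
    single g 0 * single h k = single (g * h) k := by
  ext1 n
  rw [← mul_def, coeff_single_zero_mul, coeff_single, coeff_single]
  split_ifs
  · rfl
  · exact mul_zero g

/-- `coeff_single_zero_mul` for the multiplication of the ring structure. -/
theorem coeff_single_zero_mul' (g : Hol) (Q : PsiDO) (n : ℤ) :
    (single g 0 * Q).coeff n = g * Q.coeff n := coeff_single_zero_mul g Q n

/-- The operator `∂`, with its inverse `∂⁻¹`. -/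
def del : PsiDOˣ where
  val := single 1 1
  inv := single 1 (-1)
  val_inv := del_mul_del_pow (-1)
  inv_val := by
    apply del_mul_injective
    change single 1 1 * (single 1 (-1) * single 1 1) = single 1 1 * 1
    rw [← mul_assoc]
    change (single 1 1).mul (single 1 (-1)) * single 1 1 = _
    rw [del_mul_del_pow, mul_one]
    exact one_mul _

/-- A nowhere vanishing function, as an operator of order zero. -/
def unitFun (u : Holˣ) : PsiDOˣ where
  val := single (u : Hol) 0
  inv := single ((u⁻¹ : Holˣ) : Hol) 0
  val_inv := by rw [single_zero_mul_single, Units.mul_inv, one_def]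
  inv_val := by rw [single_zero_mul_single, Units.inv_mul, one_def]

/-- The derivation `J(γ,z)^2 ∂`, invertible in the ring of pseudodifferential operators. -/
def twistedDel (γ : SL(2, ℝ)) : PsiDOˣ := unitFun (J γ ^ (2 : ℤ)) * del

theorem val_twistedDel (γ : SL(2, ℝ)) :
    (twistedDel γ : PsiDO) = single ((J γ ^ (2 : ℤ) : Holˣ) : Hol) 1 := by
  change single _ 0 * single 1 1 = _
  rw [single_zero_mul_single, mul_one]

theorem val_inv_twistedDel (γ : SL(2, ℝ)) :
    ((twistedDel γ)⁻¹ : PsiDOˣ) =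
      (single 1 (-1)).mul (single ((J γ ^ (-2 : ℤ) : Holˣ) : Hol) 0) := by
  rw [twistedDel, mul_inv_rev, zpow_neg]
  rfl

theorem transformedPow_eq (γ : SL(2, ℝ)) (k : ℤ) :
    transformedPow γ k = ((twistedDel γ ^ k : PsiDOˣ) : PsiDO) := by
  cases k with
  | ofNat n =>
    rw [transformedPow, npow_eq_pow, ← val_twistedDel, Int.ofNat_eq_natCast, zpow_natCast,
      Units.val_pow_eq_pow_val]
  | negSucc n =>
    rw [transformedPow, npow_eq_pow, ← val_inv_twistedDel, zpow_negSucc, ← inv_pow,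
      Units.val_pow_eq_pow_val]

/-- The coefficients of the action of `γ` as finite sums. -/
theorem coeff_slash {P : PsiDO} {u : ℤ} (hP : P.OrderLE u) (γ : SL(2, ℝ)) {n : ℤ} {N : ℕ}
    (hN : u - n < N) : (P.slash γ).coeff n =
      ∑ i ∈ Finset.range N, pull γ (P.coeff (u - i)) * (transformedPow γ (u - i)).coeff n := by
  change (∑ᶠ k : ℤ, pull γ (P.coeff k) * (transformedPow γ k).coeff n) = _
  let e : ℕ ↪ ℤ := ⟨fun i => u - i, fun x y h => by dsimp only at h; omega⟩
  rw [finsum_eq_sum_of_support_subset (s := (Finset.range N).map e), Finset.sum_map]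
  · rfl
  · intro k hk
    have h1 : k ≤ u := by
      by_contra h
      exact hk (by simp only [hP _ (not_le.mp h), map_zero, zero_mul])
    have h2 : n ≤ k := by
      by_contra h
      exact hk (by simp only [orderLE_transformedPow γ k _ (not_le.mp h), mul_zero])
    simp only [Finset.coe_map, Set.mem_image, Finset.mem_coe, Finset.mem_range]
    refine ⟨(u - k).toNat, by omega, ?_⟩
    change u - ((u - k).toNat : ℤ) = k
    omega

theorem OrderLE.slash {P : PsiDO} {u : ℤ} (hP : P.OrderLE u) (γ : SL(2, ℝ)) :
    (P.slash γ).OrderLE u := fun n hn => by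
  rw [coeff_slash (N := 0) hP γ (by push_cast; omega), Finset.range_zero, Finset.sum_empty]

theorem slash_add (P Q : PsiDO) (γ : SL(2, ℝ)) :
    (P + Q).slash γ = P.slash γ + Q.slash γ := by
  obtain ⟨u, hu⟩ := P.exists_orderLE
  obtain ⟨v, hv⟩ := Q.exists_orderLE
  have h1 := hu.mono (le_max_left u v)
  have h2 := hv.mono (le_max_right u v)
  ext1 n
  have hN : max u v - n < ((max u v - n).toNat + 1 : ℕ) := by omega
  rw [coeff_add, coeff_slash (h1.add h2) γ hN, coeff_slash h1 γ hN, coeff_slash h2 γ hN,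
    ← Finset.sum_add_distrib]
  simp only [coeff_add, map_add, add_mul]

/-- The action of `γ` as an additive map. -/
def slashHom (γ : SL(2, ℝ)) : PsiDO →+ PsiDO :=
  AddMonoidHom.mk' (fun P => P.slash γ) fun P Q => slash_add P Q γ

theorem slash_single (h : Hol) (k : ℤ) (γ : SL(2, ℝ)) :
    (single h k).slash γ = single (pull γ h) 0 * ((twistedDel γ ^ k : PsiDOˣ) : PsiDO) := by
  ext1 n
  rw [coeff_slash (N := (k - n).toNat + 1) (orderLE_single h k) γ (by omega),
    Finset.sum_range_succ', Finset.sum_eq_zero, coeff_single_zero_mul', transformedPow_eq]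
  · simp [coeff_single]
  · intro i _
    rw [coeff_single, if_neg (by push_cast; omega), map_zero, zero_mul]

theorem slash_single_zero_mul (h : Hol) (P : PsiDO) (γ : SL(2, ℝ)) :
    (single h 0 * P).slash γ = single (pull γ h) 0 * P.slash γ := by
  obtain ⟨u, hu⟩ := P.exists_orderLE
  have h1 : (single h 0 * P).OrderLE u := fun k hk => by
    rw [coeff_single_zero_mul', hu k hk, mul_zero]
  ext1 n
  have hN : u - n < ((u - n).toNat + 1 : ℕ) := by omega
  rw [coeff_single_zero_mul', coeff_slash h1 γ hN, coeff_slash hu γ hN, Finset.mul_sum]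
  simp only [coeff_single_zero_mul', map_mul, mul_assoc]

/-- The Leibniz rule for `J^2 ∂` and functions of the form `f(γ z)`. -/
theorem twistedDel_mul_pull (γ : SL(2, ℝ)) (h : Hol) :
    (twistedDel γ : PsiDO) * single (pull γ h) 0 =
      single (pull γ h) 0 * twistedDel γ + single (pull γ (D h)) 0 := by
  have h1 : (del : PsiDO) * single (pull γ h) 0 =
      single (pull γ h) 1 + single (D (pull γ h)) 0 := del_mul_single _ 0
  have h2 : ((J γ ^ (2 : ℤ) : Holˣ) : Hol) * ((J γ ^ (-2 : ℤ) : Holˣ) : Hol) = 1 := by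
    rw [← Units.val_mul, ← zpow_add]
    rfl
  rw [twistedDel, Units.val_mul, mul_assoc, h1, mul_add]
  change single _ 0 * _ + single _ 0 * _ = _ * (single _ 0 * single 1 1) + _
  simp only [single_zero_mul_single]
  rw [D_pull, ← mul_assoc, h2, one_mul, mul_one, mul_comm]

/-- The action of `γ` replaces a left factor `∂` by `J^2 ∂`. -/
theorem slash_del_mul (P : PsiDO) (γ : SL(2, ℝ)) :
    ((del : PsiDO) * P).slash γ = twistedDel γ * P.slash γ := by
  let Φ : PsiDO →+ PsiDO := (slashHom γ).comp (AddMonoidHom.mulLeft (del : PsiDO)) -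
    (AddMonoidHom.mulLeft (twistedDel γ : PsiDO)).comp (slashHom γ)
  refine sub_eq_zero.mp (map_eq_zero_of_single (Φ := Φ) (v := 1) (fun u P hP => ?_)
    (fun h k => sub_eq_zero.mpr ?_) P)
  · refine OrderLE.sub (OrderLE.slash (OrderLE.mono
      ((orderLE_single 1 1).mul hP) (by omega)) γ) ?_
    change OrderLE _ ((twistedDel γ : PsiDO).mul _)
    rw [val_twistedDel]
    exact ((orderLE_single _ 1).mul (hP.slash γ)).mono (by omega)
  · change ((single 1 1).mul (single h k)).slash γ = twistedDel γ * (single h k).slash γ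
    rw [del_mul_single, slash_add, slash_single, slash_single, slash_single, ← mul_assoc,
      twistedDel_mul_pull, add_mul, mul_assoc, ← Units.val_mul, ← zpow_one_add, add_comm 1 k]

theorem single_one_eq_del_zpow (k : ℤ) : single 1 k = ((del ^ k : PsiDOˣ) : PsiDO) := by
  induction k with
  | zero => rfl
  | succ k ih =>
    rw [add_comm, zpow_one_add, Units.val_mul, ← ih, add_comm]
    exact (del_mul_del_pow _).symm
  | pred k ih =>
    apply del_mul_injective
    rw [del_mul_del_pow, sub_add_cancel, ih]
    change _ = (del : PsiDO) * _
    rw [← Units.val_mul, ← zpow_one_add, add_sub_cancel]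

theorem slash_del_zpow_mul (k : ℤ) (P : PsiDO) (γ : SL(2, ℝ)) :
    (((del ^ k : PsiDOˣ) : PsiDO) * P).slash γ =
      ((twistedDel γ ^ k : PsiDOˣ) : PsiDO) * P.slash γ := by
  induction k with
  | zero => simp
  | succ k ih =>
    rw [add_comm, zpow_one_add, Units.val_mul, mul_assoc, slash_del_mul, ih, zpow_one_add,
      Units.val_mul, mul_assoc]
  | pred k ih =>
    apply (twistedDel γ).isUnit.mul_left_cancel
    rw [← slash_del_mul, ← mul_assoc, ← mul_assoc, ← Units.val_mul, ← Units.val_mul,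
      ← zpow_one_add, ← zpow_one_add, add_sub_cancel, ih]

/-- The action of `γ` respects products. -/
theorem slash_mul (P Q : PsiDO) (γ : SL(2, ℝ)) :
    (P * Q).slash γ = P.slash γ * Q.slash γ := by
  obtain ⟨v, hv⟩ := Q.exists_orderLE
  let Φ : PsiDO →+ PsiDO := (slashHom γ).comp (AddMonoidHom.mulRight Q) -
    (AddMonoidHom.mulRight (Q.slash γ)).comp (slashHom γ)
  refine sub_eq_zero.mp (map_eq_zero_of_single (Φ := Φ) (v := v) (fun u P hP => ?_)
    (fun h k => sub_eq_zero.mpr ?_) P)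
  · exact ((hP.mul hv).slash γ).sub ((hP.slash γ).mul (hv.slash γ))
  · change (single h k * Q).slash γ = (single h k).slash γ * Q.slash γ
    have h1 : single h k = single h 0 * single 1 k := by
      rw [single_zero_mul_single, mul_one]
    rw [slash_single, h1, mul_assoc, slash_single_zero_mul, single_one_eq_del_zpow,
      slash_del_zpow_mul, mul_assoc]

theorem slash_lie (P Q : PsiDO) (γ : SL(2, ℝ)) :
    (⁅P, Q⁆ : PsiDO).slash γ = ⁅P.slash γ, Q.slash γ⁆ := by
  rw [Ring.lie_def, Ring.lie_def, ← slash_mul, ← slash_mul]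
  exact map_sub (slashHom γ) (P * Q) (Q * P)

end PsiDO

/-! ### Negative powers of `J^2 ∂` and Jacobi-like forms -/

/-- The coefficient `n (n+1) ⋯ (n+i-1) · (n+1) (n+2) ⋯ (n+i) / i!` in the expansion
`(J^2 ∂)^{-n} = J^{-2n} ∑_i delCoeff n i · K^i ∂^{-n-i}`. -/
def delCoeff (n i : ℕ) : ℂ := ((n.ascFactorial i * (n + 1).ascFactorial i : ℕ) : ℂ) / (i ! : ℂ)

theorem delCoeff_zero_right (n : ℕ) : delCoeff n 0 = 1 := by simp [delCoeff]

theorem delCoeff_zero_succ (i : ℕ) : delCoeff 0 (i + 1) = 0 := by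
  simp [delCoeff, Nat.zero_ascFactorial]

/-- The recursion that expresses `J^2 ∂ · (J^2 ∂)^{-(n+1)} = (J^2 ∂)^{-n}`; the factor `2n+2+i`
comes from differentiating `J^{-2n-2} K^i`. -/
theorem delCoeff_succ_succ (n i : ℕ) :
    delCoeff (n + 1) (i + 1) = delCoeff n (i + 1) + (2 * n + 2 + i) * delCoeff (n + 1) i := by
  have h1 : n.ascFactorial (i + 1) = n * (n + 1).ascFactorial i := by
    rw [Nat.ascFactorial_succ, Nat.succ_ascFactorial]
  have h2 : (n + 1).ascFactorial (i + 1) = (n + 1) * (n + 1 + 1).ascFactorial i := by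
    rw [Nat.ascFactorial_succ, Nat.succ_ascFactorial]
  have h3 : (n + 1 + 1).ascFactorial (i + 1) = (n + 1 + 1 + i) * (n + 1 + 1).ascFactorial i :=
    Nat.ascFactorial_succ ..
  have h4 : (n + 1).ascFactorial (i + 1) = (n + 1 + i) * (n + 1).ascFactorial i :=
    Nat.ascFactorial_succ ..
  have hi : ((i : ℂ) + 1) ≠ 0 := Nat.cast_add_one_ne_zero i
  have hf : (i ! : ℂ) ≠ 0 := Nat.cast_ne_zero.mpr i.factorial_ne_zero
  have e1 : delCoeff (n + 1) (i + 1) =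
      (((n + 1 + i) * (n + 1).ascFactorial i * ((n + 1 + 1 + i) * (n + 1 + 1).ascFactorial i) : ℕ)
        : ℂ) / ((i + 1)! : ℂ) := by rw [delCoeff, h3, h4]
  have e2 : delCoeff n (i + 1) =
      ((n * (n + 1).ascFactorial i * ((n + 1) * (n + 1 + 1).ascFactorial i) : ℕ) : ℂ) /
        ((i + 1)! : ℂ) := by rw [delCoeff, h1, h2]
  rw [e1, e2, delCoeff, Nat.factorial_succ]
  push_cast
  field_simp
  ring

/-- The constants `C_η` absorb the coefficients of `(J^2 ∂)^{-n}`: they turn them into those of the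
exponential series in `-K`. -/
theorem Cst_add (n i : ℕ) (hn : 0 < n) :
    Cst ((n + i : ℕ) : ℤ) = (-1) ^ i * (i ! : ℂ) * delCoeff n i * Cst n := by
  obtain ⟨k, rfl⟩ := Nat.exists_eq_succ_of_ne_zero hn.ne'
  have hf : (i ! : ℂ) ≠ 0 := Nat.cast_ne_zero.mpr i.factorial_ne_zero
  have h1 := Nat.factorial_mul_ascFactorial k i
  have h2 := Nat.factorial_mul_ascFactorial (k + 1) i
  simp only [Cst, Int.toNat_natCast, delCoeff, Nat.succ_eq_add_one]
  rw [show k + 1 + i - 1 = k + i by omega, Nat.add_sub_cancel, ← h1, ← h2]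
  push_cast
  field_simp
  ring

theorem Cst_ne_zero (n : ℤ) : Cst n ≠ 0 :=
  mul_ne_zero (pow_ne_zero _ (by norm_num)) (Nat.cast_ne_zero.mpr
    (mul_ne_zero (Nat.factorial_ne_zero _) (Nat.factorial_ne_zero _)))

namespace PsiDO

/-- The explicit expansion of `(J^2 ∂)^{-n}`. -/
def negPow (γ : SL(2, ℝ)) (n : ℕ) : PsiDO :=
  ⟨fun j => if j ≤ -n then
      delCoeff n (-n - j).toNat • (((J γ ^ (-2 * n : ℤ) : Holˣ) : Hol) * K γ ^ (-n - j).toNat)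
    else 0, -n, fun _ hj => if_neg (not_le.mpr hj)⟩

theorem coeff_negPow (γ : SL(2, ℝ)) (n i : ℕ) : (negPow γ n).coeff (-n - i) =
    delCoeff n i • (((J γ ^ (-2 * n : ℤ) : Holˣ) : Hol) * K γ ^ i) := by
  change (if _ then _ else _) = _
  rw [if_pos (by omega), show -(n : ℤ) - (-n - i) = i by ring, Int.toNat_natCast]

theorem orderLE_negPow (γ : SL(2, ℝ)) (n : ℕ) : (negPow γ n).OrderLE (-n) :=
  fun _ hj => if_neg (not_le.mpr hj)

/-- Two operators of order at most `u` agree if their coefficients in degrees `u - k` do. -/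
theorem OrderLE.ext {P Q : PsiDO} {u : ℤ} (hP : P.OrderLE u) (hQ : Q.OrderLE u)
    (h : ∀ k : ℕ, P.coeff (u - k) = Q.coeff (u - k)) : P = Q := by
  ext1 n
  by_cases hn : u < n
  · rw [hP n hn, hQ n hn]
  · have h1 := h (u - n).toNat
    rwa [show u - ((u - n).toNat : ℤ) = n by omega] at h1

theorem negPow_zero (γ : SL(2, ℝ)) : negPow γ 0 = 1 := by
  refine (orderLE_negPow γ 0).ext (orderLE_single 1 0) fun k => ?_
  rw [coeff_negPow, one_def, coeff_single]
  cases k with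
  | zero => simp [delCoeff_zero_right]
  | succ k =>
    rw [delCoeff_zero_succ, zero_smul, if_neg]
    push_cast
    omega

/-- `D (J^{-2n-2} K^i) = -(2n+2+i) J^{-2n-2} K^{i+1}`, so that the coefficients on the left are
those of the recursion `delCoeff_succ_succ`. -/
theorem twistedDel_mul_negPow (γ : SL(2, ℝ)) (n : ℕ) :
    (twistedDel γ : PsiDO) * negPow γ (n + 1) = negPow γ n := by
  have h1 : ((twistedDel γ : PsiDO) * negPow γ (n + 1)).OrderLE (-n) := by
    rw [val_twistedDel]
    exact ((orderLE_single _ 1).mul (orderLE_negPow γ (n + 1))).mono (by push_cast; omega)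
  have hJ : ((J γ ^ (-2 * n : ℤ) : Holˣ) : Hol) = ((J γ ^ (2 : ℤ) : Holˣ) : Hol) *
      ((J γ ^ (-2 * (n + 1 : ℕ) : ℤ) : Holˣ) : Hol) := by
    rw [← Units.val_mul, ← zpow_add]
    congr 2
    push_cast
    ring
  refine h1.ext (orderLE_negPow γ n) fun i => ?_
  rw [val_twistedDel, ← mul_def, coeff_single_one_mul, coeff_negPow, hJ]
  have e1 : -(n : ℤ) - i - 1 = -((n + 1 : ℕ) : ℤ) - i := by push_cast; ring
  rw [e1, coeff_negPow]
  cases i with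
  | zero =>
    rw [orderLE_negPow γ (n + 1) _ (by push_cast; omega), D_zero, delCoeff_zero_right,
      delCoeff_zero_right, add_zero, one_smul, one_smul, pow_zero, mul_one, mul_one]
  | succ i =>
    have e2 : -(n : ℤ) - (i + 1 : ℕ) = -((n + 1 : ℕ) : ℤ) - i := by push_cast; ring
    rw [e2, coeff_negPow, D_smul, D_mul, D_J_zpow, D_K_pow, delCoeff_succ_succ, add_smul]
    simp only [Algebra.smul_def, map_mul, map_add, map_natCast, map_ofNat]
    push_cast
    ring

/-- The expansion of the negative powers of `J^2 ∂` in powers of `∂`. -/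
theorem transformedPow_neg (γ : SL(2, ℝ)) (n : ℕ) : transformedPow γ (-n) = negPow γ n := by
  rw [transformedPow_eq]
  induction n with
  | zero => simp [negPow_zero]
  | succ n ih =>
    apply (twistedDel γ).isUnit.mul_left_cancel
    rw [twistedDel_mul_negPow, ← ih, ← Units.val_mul, ← zpow_one_add]
    congr 2
    push_cast
    ring

end PsiDO

theorem orderLE_toPsiDO (ξ : ℤ) (F : PowerSeries Hol) : (toPsiDO ξ F).OrderLE (-ξ) :=
  fun _ hn => if_neg (by omega)

theorem coeff_toPsiDO (ξ : ℤ) (F : PowerSeries Hol) (k : ℕ) :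
    (toPsiDO ξ F).coeff (-ξ - k) = Cst (ξ + k) • PowerSeries.coeff k F := by
  change (if _ then _ else _) = _
  rw [if_pos (by omega), show -(-ξ - (k : ℤ)) = ξ + k by ring,
    show (ξ + k - ξ).toNat = k by omega]

theorem toPsiDO_injective (ξ : ℤ) : Function.Injective (toPsiDO ξ) := by
  intro F G h
  ext1 k
  have h1 := congrArg (PsiDO.coeff · (-ξ - k)) h
  simp only [coeff_toPsiDO] at h1
  exact smul_right_injective _ (Cst_ne_zero _) h1

theorem toPsiDO_surjective {ξ : ℤ} {P : PsiDO} (hP : P.OrderLE (-ξ)) :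
    ∃ F, toPsiDO ξ F = P := by
  refine ⟨PowerSeries.mk fun k => (Cst (ξ + k))⁻¹ • P.coeff (-ξ - k), ?_⟩
  refine (orderLE_toPsiDO ξ _).ext hP fun k => ?_
  rw [coeff_toPsiDO, PowerSeries.coeff_mk, smul_inv_smul₀ (Cst_ne_zero _)]

/-- Multiplication by `X^δ` amounts to a shift of the weight. -/
theorem toPsiDO_X_pow_mul (ξ : ℤ) (δ : ℕ) (F : PowerSeries Hol) :
    toPsiDO ξ (PowerSeries.X ^ δ * F) = toPsiDO (δ + ξ) F := by
  refine (orderLE_toPsiDO ξ _).ext ((orderLE_toPsiDO _ F).mono (by omega)) fun k => ?_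
  rw [coeff_toPsiDO, PowerSeries.coeff_X_pow_mul']
  split_ifs with h
  · have e : -ξ - (k : ℤ) = -(δ + ξ) - (k - δ : ℕ) := by push_cast [h]; ring
    rw [e, coeff_toPsiDO]
    congr 2
    push_cast [h]
    ring
  · rw [orderLE_toPsiDO _ F _ (by omega), smul_zero]

theorem coeff_slashJ (w : ℤ) (γ : SL(2, ℝ)) (F : PowerSeries Hol) (k : ℕ) :
    PowerSeries.coeff k (slashJ w γ F) = ∑ i ∈ Finset.range (k + 1),
      ((((k - i)! : ℕ) : ℂ)⁻¹) • (((J γ ^ (-w - 2 * i) : Holˣ) : Hol) * (-K γ) ^ (k - i) *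
        pull γ (PowerSeries.coeff i F)) := by
  rw [slashJ, mul_assoc, PowerSeries.coeff_C_mul, mul_comm (PowerSeries.mk _),
    PowerSeries.coeff_mul, Finset.Nat.sum_antidiagonal_eq_sum_range_succ_mk, Finset.mul_sum]
  refine Finset.sum_congr rfl fun i _ => ?_
  rw [PowerSeries.coeff_rescale, PowerSeries.coeff_mk, PowerSeries.coeff_map,
    sub_eq_add_neg, zpow_add, Units.val_mul,
    show -(2 * (i : ℤ)) = -2 * i by ring, zpow_mul, zpow_natCast, Units.val_pow_eq_pow_val,
    mul_smul_comm, mul_smul_comm]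
  congr 1
  change _ * (_ * pull γ _ * _) = _
  ring

theorem slashJ_X_pow_mul (w : ℤ) (γ : SL(2, ℝ)) (δ : ℕ) (F : PowerSeries Hol) :
    slashJ w γ (PowerSeries.X ^ δ * F) = PowerSeries.X ^ δ * slashJ (w + 2 * δ) γ F := by
  have h : ((J γ ^ (-w) : Holˣ) : Hol) * ((J γ ^ (-2 : ℤ) : Holˣ) : Hol) ^ δ =
      ((J γ ^ (-(w + 2 * δ)) : Holˣ) : Hol) := by
    rw [← Units.val_pow_eq_pow_val, ← Units.val_mul, ← zpow_natCast, ← zpow_mul, ← zpow_add]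
    congr 2
    ring
  rw [slashJ, slashJ, ← h]
  simp only [map_mul, map_pow, PowerSeries.map_X, PowerSeries.rescale_X]
  ring

/-- The action of `γ` on Jacobi-like forms corresponds to its action on pseudodifferential
operators. -/
theorem toPsiDO_slashJ (n : ℕ) (hn : 0 < n) (γ : SL(2, ℝ)) (F : PowerSeries Hol) :
    toPsiDO n (slashJ (2 * n) γ F) = (toPsiDO n F).slash γ := by
  refine (orderLE_toPsiDO n _).ext ((orderLE_toPsiDO n F).slash γ) fun k => ?_
  rw [coeff_toPsiDO, coeff_slashJ, PsiDO.coeff_slash (N := k + 1) (orderLE_toPsiDO n F) γ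
    (by push_cast; omega), Finset.smul_sum]
  refine Finset.sum_congr rfl fun i hi => ?_
  obtain ⟨j, rfl⟩ := Nat.exists_eq_add_of_le (Nat.le_of_lt_succ (Finset.mem_range.mp hi))
  have e1 : -(n : ℤ) - i = -((n + i : ℕ) : ℤ) := by push_cast; ring
  have e2 : -(n : ℤ) - (i + j : ℕ) = -((n + i : ℕ) : ℤ) - j := by push_cast; ring
  have e3 : (n : ℤ) + (i + j : ℕ) = ((n + i + j : ℕ) : ℤ) := by push_cast; ring
  have e4 : -2 * ((n + i : ℕ) : ℤ) = -(2 * n) - 2 * i := by push_cast; ring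
  have hf : (j ! : ℂ) ≠ 0 := Nat.cast_ne_zero.mpr j.factorial_ne_zero
  rw [coeff_toPsiDO, e1, e2, e3, PsiDO.transformedPow_neg, PsiDO.coeff_negPow,
    Nat.add_sub_cancel_left, Cst_add _ j (by omega), e4, map_smul, smul_mul_smul_comm, smul_smul,
    show (n : ℤ) + i = ((n + i : ℕ) : ℤ) by push_cast; ring, neg_pow (K γ)]
  have h1 : (-1 : Hol) ^ j = algebraMap ℂ Hol ((-1) ^ j) := by simp
  have h2 : ((-1 : ℂ) ^ j) * (-1) ^ j = 1 := by rw [← mul_pow]; simp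
  rw [h1, show ∀ a c d : Hol, ∀ b : ℂ, a * (algebraMap ℂ Hol b * c) * d = b • (d * (a * c)) by
    intro a c d b; rw [Algebra.smul_def]; ring, smul_smul]
  congr 1
  field_simp
  linear_combination (Cst ((n + i : ℕ) : ℤ) * delCoeff (n + i) j) * h2

/-! ### The commutator in coordinates -/

/-- The numerical identity behind the bracket `bracketX`. The signs of `choose (-N) q = ± choose
(N + q - 1) q` and of the constants `C_η` cancel, and the quotient on the right is the constant
`Xi`. -/
theorem choose_mul_Cst (N M q : ℕ) (hN : 0 < N) :
    ((Ring.choose (-(N : ℤ)) q : ℤ) : ℂ) * (Cst N * Cst M) = Cst ((N + M + q : ℕ) : ℤ) *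
      (((N ! * (N + q - 1)! * M ! * (M - 1)! : ℕ) : ℂ) /
        ((q ! * (N + M + q)! * (N + M + q - 1)! : ℕ) : ℂ)) := by
  obtain ⟨n, rfl⟩ := Nat.exists_eq_succ_of_ne_zero hN.ne'
  have h1 : Ring.choose (((n + 1 : ℕ) : ℤ) + q - 1) q = (((n + q).choose q : ℕ) : ℤ) := by
    rw [← Ring.choose_natCast]
    congr 1
    push_cast
    ring
  have h2 : (((n + q).choose q : ℕ) : ℂ) * q ! * n ! = ((n + q)! : ℕ) := by
    rw [← Nat.add_choose_mul_factorial_mul_factorial n q, ← Nat.choose_symm_add]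
    push_cast
    ring
  have hC : ∀ k : ℕ, Cst (k : ℤ) = (-1) ^ k * ((k ! : ℂ) * ((k - 1)! : ℂ)) := fun k => by
    rw [Cst, Int.toNat_natCast, Nat.cast_mul]
  have h5 : ((Int.negOnePow (q : ℤ) • (((n + q).choose q : ℕ) : ℤ) : ℤ) : ℂ) =
      (-1) ^ q * (((n + q).choose q : ℕ) : ℂ) := by
    rw [Units.smul_def, Int.coe_negOnePow_natCast, smul_eq_mul, Int.cast_mul, Int.cast_pow,
      Int.cast_neg, Int.cast_one, Int.cast_natCast]
  rw [Ring.choose_neg, Nat.succ_eq_add_one, h1, h5, hC, hC, hC,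
    show n + 1 + q - 1 = n + q by omega, Nat.add_sub_cancel, Nat.cast_mul, Nat.cast_mul,
    Nat.cast_mul, Nat.cast_mul, Nat.cast_mul, ← h2]
  have hq : (q ! : ℂ) ≠ 0 := Nat.cast_ne_zero.mpr q.factorial_ne_zero
  have h3 : ((n + 1 + M + q)! : ℂ) ≠ 0 := Nat.cast_ne_zero.mpr (Nat.factorial_ne_zero _)
  have h4 : ((n + 1 + M + q - 1)! : ℂ) ≠ 0 := Nat.cast_ne_zero.mpr (Nat.factorial_ne_zero _)
  field_simp
  ring

/-- The coefficients of a product of two operators of given orders. -/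
theorem PsiDO.coeff_mul {P Q : PsiDO} {u v : ℤ} (hP : P.OrderLE u) (hQ : Q.OrderLE v) (r : ℕ) :
    (P * Q).coeff (u + v - r) = ∑ p ∈ Finset.range (r + 1), ∑ q ∈ Finset.range (p + 1),
      (Ring.choose (u - (r - p : ℕ)) q : ℤ) •
        (P.coeff (u - (r - p : ℕ)) * D^[q] (Q.coeff (v - (p - q : ℕ)))) := by
  change mulCoeff _ _ _ = _
  rw [mulCoeff_eq_sum (M := r + 1) (N := r + 1) hP hQ (by push_cast; omega) (by push_cast; omega),
    ← Finset.sum_range_reflect]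
  refine Finset.sum_congr rfl fun p hp => ?_
  have hp := Nat.le_of_lt_succ (Finset.mem_range.mp hp)
  rw [Nat.add_sub_cancel]
  symm
  refine Finset.sum_subset_zero_on_sdiff (Finset.range_subset_range.mpr (by omega))
    (fun q hq => ?_) fun q hq => ?_
  · simp only [Finset.mem_sdiff, Finset.mem_range] at hq
    rw [hQ _ (by push_cast [hp]; omega), D_iterate_zero, mul_zero, smul_zero]
  · have hq := Nat.le_of_lt_succ (Finset.mem_range.mp hq)
    rw [show u + v - r - (u - ((r - p : ℕ) : ℤ)) + q = v - ((p - q : ℕ) : ℤ) by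
      push_cast [hp, hq]; ring]

/-- The product of two operators of negative order, in the coordinates given by `toPsiDO`. -/
theorem coeff_toPsiDO_mul {α β : ℕ} (hα : 0 < α) (F G : PowerSeries Hol) (r : ℕ) :
    (toPsiDO α F * toPsiDO β G).coeff (-α + -β - r) = Cst ((α + β + r : ℕ) : ℤ) •
      ∑ p ∈ Finset.range (r + 1), ∑ q ∈ Finset.range (p + 1), Xi α β r p q •
        (PowerSeries.coeff (r - p) F * D^[q] (PowerSeries.coeff (p - q) G)) := by
  rw [PsiDO.coeff_mul (orderLE_toPsiDO _ F) (orderLE_toPsiDO _ G), Finset.smul_sum]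
  refine Finset.sum_congr rfl fun p hp => ?_
  rw [Finset.smul_sum]
  refine Finset.sum_congr rfl fun q hq => ?_
  obtain ⟨j, rfl⟩ := Nat.exists_eq_add_of_le (Nat.le_of_lt_succ (Finset.mem_range.mp hq))
  obtain ⟨i, rfl⟩ := Nat.exists_eq_add_of_le (Nat.le_of_lt_succ (Finset.mem_range.mp hp))
  have h := choose_mul_Cst (α + i) (β + j) q (by omega)
  rw [coeff_toPsiDO, coeff_toPsiDO, D_iterate_eq, D_iterate_eq, map_smul, smul_mul_smul_comm,
    Nat.add_sub_cancel_left, Nat.add_sub_cancel_left, ← Int.cast_smul_eq_zsmul ℂ, smul_smul,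
    smul_smul]
  congr 1
  rw [show -(α : ℤ) - i = -((α + i : ℕ) : ℤ) by push_cast; ring,
    show (α : ℤ) + i = ((α + i : ℕ) : ℤ) by push_cast; ring,
    show (β : ℤ) + j = ((β + j : ℕ) : ℤ) by push_cast; ring, h, Xi,
    show α + i + (β + j) + q = α + β + (q + j + i) by omega, Nat.add_sub_cancel_left,
    Nat.add_sub_cancel_left, show α + i + q - 1 = i + q + α - 1 by omega, add_comm α i,
    add_comm β j, show α + β + (q + j + i) = q + j + i + α + β by omega]

theorem coeff_bracketX_zero (α β : ℕ) (F G : PowerSeries Hol) (r : ℕ) :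
    PowerSeries.coeff r (bracketX 0 0 α β F G) =
      ∑ p ∈ Finset.range (r + 1), ∑ q ∈ Finset.range (p + 1),
        (Xi α β r p q • (PowerSeries.coeff (r - p) F * D^[q] (PowerSeries.coeff (p - q) G)) -
          Xi β α r p q • (PowerSeries.coeff (r - p) G * D^[q] (PowerSeries.coeff (p - q) F))) := by
  simp [bracketX]

/-- Factors `X^δ₁` and `X^δ₂` can be moved out of the bracket, at the cost of a shift of the
weights. -/
theorem bracketX_X_pow_mul (δ₁ δ₂ : ℕ) {ξ₁ ξ₂ : ℤ} {α β : ℕ} (hα : δ₁ + ξ₁ = α)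
    (hβ : δ₂ + ξ₂ = β) (F G : PowerSeries Hol) :
    bracketX δ₁ δ₂ ξ₁ ξ₂ (PowerSeries.X ^ δ₁ * F) (PowerSeries.X ^ δ₂ * G) =
      PowerSeries.X ^ (δ₁ + δ₂) * bracketX 0 0 α β F G := by
  simp [bracketX, hα, hβ, PowerSeries.coeff_X_pow_mul]

theorem toPsiDO_bracketX_zero {α β : ℕ} (hα : 0 < α) (hβ : 0 < β) (F G : PowerSeries Hol) :
    toPsiDO (α + β) (bracketX 0 0 α β F G) = ⁅toPsiDO α F, toPsiDO β G⁆ := by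
  refine (orderLE_toPsiDO _ _).ext
    (((orderLE_toPsiDO _ F).lie (orderLE_toPsiDO _ G)).mono (by omega)) fun r => ?_
  rw [coeff_toPsiDO, coeff_bracketX_zero, Ring.lie_def, PsiDO.coeff_sub, neg_add,
    coeff_toPsiDO_mul hα, add_comm (-(α : ℤ)), coeff_toPsiDO_mul hβ, add_comm β α,
    ← smul_sub, ← Nat.cast_add, ← Nat.cast_add]
  simp only [Finset.sum_sub_distrib]

/-- The bracket of power series is transported from the commutator. -/
theorem toPsiDO_bracketX {δ₁ δ₂ : ℕ} {ξ₁ ξ₂ : ℤ} (h₁ : 0 < δ₁ + ξ₁) (h₂ : 0 < δ₂ + ξ₂)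
    {F G : PowerSeries Hol} (hF : PowerSeries.X ^ δ₁ ∣ F) (hG : PowerSeries.X ^ δ₂ ∣ G) :
    toPsiDO (ξ₁ + ξ₂) (bracketX δ₁ δ₂ ξ₁ ξ₂ F G) = ⁅toPsiDO ξ₁ F, toPsiDO ξ₂ G⁆ := by
  obtain ⟨F, rfl⟩ := hF
  obtain ⟨G, rfl⟩ := hG
  obtain ⟨α, hα⟩ := Int.eq_ofNat_of_zero_le h₁.le
  obtain ⟨β, hβ⟩ := Int.eq_ofNat_of_zero_le h₂.le
  rw [bracketX_X_pow_mul δ₁ δ₂ hα hβ, toPsiDO_X_pow_mul, toPsiDO_X_pow_mul, toPsiDO_X_pow_mul,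
    hα, hβ, ← toPsiDO_bracketX_zero (by omega) (by omega)]
  congr 1
  push_cast
  omega

/-- Equivariance of the bracket of power series, read off from that of the commutator. -/
theorem slashJ_bracketX_zero {α β : ℕ} (hα : 0 < α) (hβ : 0 < β) (γ : SL(2, ℝ))
    (F G : PowerSeries Hol) :
    slashJ (2 * (α + β)) γ (bracketX 0 0 α β F G) =
      bracketX 0 0 α β (slashJ (2 * α) γ F) (slashJ (2 * β) γ G) := by
  apply toPsiDO_injective (α + β)
  have h := toPsiDO_slashJ (α + β) (by omega) γ (bracketX 0 0 α β F G)
  push_cast at h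
  rw [h, toPsiDO_bracketX_zero hα hβ, toPsiDO_bracketX_zero hα hβ, PsiDO.slash_lie,
    toPsiDO_slashJ α hα, toPsiDO_slashJ β hβ]

/-! ### The projections to polynomials -/

theorem coeff_PiJ_zero (m : ℕ) (F : PowerSeries Hol) (r : ℕ) :
    (PiJ 0 m F).coeff r =
      if r ≤ m then ((r ! : ℂ)⁻¹) • PowerSeries.coeff (m - r) F else 0 := by
  simp only [PiJ, Polynomial.finsetSum_coeff, Polynomial.coeff_monomial, Finset.sum_ite_eq',
    Finset.mem_range, Nat.lt_succ_iff, add_zero]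

theorem natDegree_PiJ_zero (m : ℕ) (F : PowerSeries Hol) : (PiJ 0 m F).natDegree ≤ m := by
  refine Polynomial.natDegree_le_iff_coeff_eq_zero.mpr fun r hr => ?_
  rw [coeff_PiJ_zero, if_neg (not_le.mpr hr)]

theorem PiJ_X_pow_mul (δ m : ℕ) (F : PowerSeries Hol) :
    PiJ δ m (PowerSeries.X ^ δ * F) = PiJ 0 m F := by
  simp [PiJ, PowerSeries.coeff_X_pow_mul]

/-- Every polynomial of degree at most `m` lifts to a power series. -/
theorem exists_PiJ_zero_eq {m : ℕ} {p : Polynomial Hol} (hp : p.natDegree ≤ m) :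
    ∃ F, PiJ 0 m F = p := by
  refine ⟨PowerSeries.mk fun k => ((m - k)! : ℂ) • p.coeff (m - k), ?_⟩
  ext1 r
  rw [coeff_PiJ_zero]
  split_ifs with h
  · rw [PowerSeries.coeff_mk, Nat.sub_sub_self h,
      inv_smul_smul₀ (Nat.cast_ne_zero.mpr r.factorial_ne_zero)]
  · rw [Polynomial.coeff_eq_zero_of_natDegree_lt (by omega)]

theorem PiPsi_toPsiDO (ε : ℤ) (m : ℕ) (F : PowerSeries Hol) :
    PiPsi ε m (toPsiDO ε F) = PiJ 0 m F := by
  refine Finset.sum_congr rfl fun r _ => ?_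
  rw [show -((m - r : ℕ) : ℤ) - ε = -ε - (m - r : ℕ) by ring, coeff_toPsiDO, smul_smul, mul_inv,
    add_comm ε, inv_mul_cancel_right₀ (Cst_ne_zero _), add_zero]

/-- The projection to polynomials transports `bracketX` to `bracketQ`. -/
theorem PiJ_bracketX_zero (m ξ₁ ξ₂ : ℕ) (F G : PowerSeries Hol) :
    PiJ 0 m (bracketX 0 0 ((ξ₁ - m : ℕ) : ℤ) ((ξ₂ - m : ℕ) : ℤ) F G) =
      bracketQ m ξ₁ ξ₂ (PiJ 0 m F) (PiJ 0 m G) := by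
  refine Finset.sum_congr rfl fun r hr => ?_
  have hr := Nat.le_of_lt_succ (Finset.mem_range.mp hr)
  rw [add_zero, coeff_bracketX_zero, Finset.smul_sum]
  congr 1
  refine Finset.sum_congr rfl fun p hp => ?_
  rw [Finset.smul_sum]
  refine Finset.sum_congr rfl fun q hq => ?_
  have hp := Nat.le_of_lt_succ (Finset.mem_range.mp hp)
  have hq := Nat.le_of_lt_succ (Finset.mem_range.mp hq)
  have h1 : (((r + p)! : ℕ) : ℂ) ≠ 0 := Nat.cast_ne_zero.mpr (Nat.factorial_ne_zero _)
  have h2 : (((m - p + q)! : ℕ) : ℂ) ≠ 0 := Nat.cast_ne_zero.mpr (Nat.factorial_ne_zero _)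
  have e1 : m - (r + p) = m - r - p := by omega
  have e2 : m - (m - p + q) = p - q := by omega
  simp only [coeff_PiJ_zero, if_pos (show r + p ≤ m by omega),
    if_pos (show m - p + q ≤ m by omega), e1, e2, D_iterate_eq, map_smul, smul_mul_smul_comm,
    smul_sub, smul_smul]
  push_cast
  congr 2 <;> field_simp

theorem coeff_slashP {m : ℕ} {p : Polynomial Hol} (hp : p.natDegree ≤ m) (w : ℤ) (γ : SL(2, ℝ))
    (r : ℕ) : (slashP w γ p).coeff r = ∑ s ∈ Finset.range (m + 1),
      (s.choose r : Hol) * (((J γ ^ (-w + 2 * s) : Holˣ) : Hol) * (-K γ) ^ (s - r) *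
        pull γ (p.coeff s)) := by
  have hp' : (p.map (pull γ : Hol →+* Hol)).natDegree < m + 1 :=
    (Polynomial.natDegree_map_le).trans_lt (Nat.lt_succ_of_le hp)
  have hX : (Polynomial.X - Polynomial.C (K γ) : Polynomial Hol) =
      Polynomial.X + Polynomial.C (-K γ) := by
    rw [Polynomial.C_neg]; exact sub_eq_add_neg (G := Polynomial Hol) _ _
  rw [slashP, Polynomial.coeff_C_mul, Polynomial.comp, Polynomial.eval₂_eq_sum_range' _ hp',
    Polynomial.finsetSum_coeff, Finset.mul_sum]
  refine Finset.sum_congr rfl fun s _ => ?_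
  rw [mul_pow, ← Polynomial.C_pow, Polynomial.coeff_C_mul, Polynomial.coeff_C_mul,
    hX, Polynomial.coeff_X_add_C_pow, Polynomial.coeff_map, zpow_add, Units.val_mul, zpow_mul,
    zpow_natCast, Units.val_pow_eq_pow_val]
  change _ * (pull γ _ * _) = _
  ring

/-- The projection to polynomials respects the actions of `SL(2, ℝ)`. -/
theorem PiJ_slashJ (m : ℕ) (ε : ℤ) (γ : SL(2, ℝ)) (F : PowerSeries Hol) :
    PiJ 0 m (slashJ (2 * ε) γ F) = slashP (2 * (ε + m)) γ (PiJ 0 m F) := by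
  ext1 r
  rw [coeff_slashP (natDegree_PiJ_zero m F), ← Finset.sum_range_reflect, coeff_PiJ_zero]
  split_ifs with hr
  · rw [coeff_slashJ, Finset.smul_sum]
    refine Finset.sum_subset_zero_on_sdiff (Finset.range_subset_range.mpr (by omega))
      (fun i hi => ?_) fun i hi => ?_
    · -- here `m - i < r`, so that the binomial coefficient vanishes
      simp only [Finset.mem_sdiff, Finset.mem_range] at hi
      rw [Nat.choose_eq_zero_of_lt (by omega), Nat.cast_zero, zero_mul]
    · have hi := Nat.le_of_lt_succ (Finset.mem_range.mp hi)
      obtain ⟨j, hj⟩ := Nat.exists_eq_add_of_le hi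
      have hs : m + 1 - 1 - i = r + j := by omega
      have e : -(2 * (ε + m)) + 2 * ((r + j : ℕ) : ℤ) = -(2 * ε) - 2 * i := by
        have : (m : ℤ) = r + i + j := by omega
        rw [this]
        push_cast
        ring
      rw [hs, e, coeff_PiJ_zero, if_pos (by omega), map_smul, hj, Nat.add_sub_cancel_left,
        Nat.add_sub_cancel_left, show m - (r + j) = i by omega, mul_smul_comm, mul_smul_comm,
        ← nsmul_eq_mul, ← Nat.cast_smul_eq_nsmul ℂ, smul_smul, smul_smul]
      congr 1
      have h2 : (((r + j).choose r : ℕ) : ℂ) * r ! * j ! = ((r + j)! : ℕ) := by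
        rw [← Nat.add_choose_mul_factorial_mul_factorial r j, ← Nat.choose_symm_add]
        push_cast
        ring
      have h3 : (((r + j)! : ℕ) : ℂ) ≠ 0 := Nat.cast_ne_zero.mpr (Nat.factorial_ne_zero _)
      have h4 : ((r ! : ℕ) : ℂ) ≠ 0 := Nat.cast_ne_zero.mpr (Nat.factorial_ne_zero _)
      have h5 : ((j ! : ℕ) : ℂ) ≠ 0 := Nat.cast_ne_zero.mpr (Nat.factorial_ne_zero _)
      field_simp
      linear_combination -h2
  · symm
    refine Finset.sum_eq_zero fun i _ => ?_
    rw [Nat.choose_eq_zero_of_lt (by omega), Nat.cast_zero, zero_mul]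

/-! ### The bracket of quasimodular polynomials -/

theorem natDegree_PiPsi (ε : ℤ) (m : ℕ) (P : PsiDO) : (PiPsi ε m P).natDegree ≤ m := by
  refine Polynomial.natDegree_le_iff_coeff_eq_zero.mpr fun r hr => ?_
  simp only [PiPsi, Polynomial.finsetSum_coeff, Polynomial.coeff_monomial, Finset.sum_ite_eq',
    Finset.mem_range]
  exact if_neg (by omega)

theorem PiPsi_zero (ε : ℤ) (m : ℕ) : PiPsi ε m 0 = 0 := by
  simp [PiPsi]

theorem PiPsi_add (ε : ℤ) (m : ℕ) (P Q : PsiDO) :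
    PiPsi ε m (P + Q) = PiPsi ε m P + PiPsi ε m Q := by
  simp only [PiPsi, PsiDO.coeff_add, smul_add, map_add, Finset.sum_add_distrib]

/-- Every polynomial of degree at most `m` lifts to a pseudodifferential operator. -/
theorem exists_PiPsi_eq {m : ℕ} (ε : ℤ) {p : Polynomial Hol} (hp : p.natDegree ≤ m) :
    ∃ P : PsiDO, P.OrderLE (-ε) ∧ PiPsi ε m P = p := by
  obtain ⟨F, rfl⟩ := exists_PiJ_zero_eq hp
  exact ⟨toPsiDO ε F, orderLE_toPsiDO ε F, PiPsi_toPsiDO ε m F⟩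

/-- The projection of operators to polynomials respects the actions of `SL(2, ℝ)`. -/
theorem PiPsi_slash {m ξ : ℕ} (hξ : m < ξ) {P : PsiDO} (hP : P.OrderLE (-(ξ - m)))
    (γ : SL(2, ℝ)) :
    PiPsi (ξ - m) m (P.slash γ) = slashP (2 * ξ) γ (PiPsi (ξ - m) m P) := by
  obtain ⟨F, rfl⟩ := toPsiDO_surjective hP
  have h := toPsiDO_slashJ (ξ - m) (by omega) γ F
  rw [Nat.cast_sub hξ.le] at h
  rw [← h, PiPsi_toPsiDO, PiPsi_toPsiDO, PiJ_slashJ, sub_add_cancel]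

/-- The projection of a commutator depends only on the projections of its entries, through the
explicit bracket. -/
theorem PiPsi_lie {m ξ₁ ξ₂ : ℕ} (h₁ : m < ξ₁) (h₂ : m < ξ₂) {P Q : PsiDO}
    (hP : P.OrderLE (-(ξ₁ - m))) (hQ : Q.OrderLE (-(ξ₂ - m))) :
    PiPsi (ξ₁ - m + (ξ₂ - m)) m ⁅P, Q⁆ =
      bracketQ m ξ₁ ξ₂ (PiPsi (ξ₁ - m) m P) (PiPsi (ξ₂ - m) m Q) := by
  obtain ⟨F, rfl⟩ := toPsiDO_surjective hP
  obtain ⟨G, rfl⟩ := toPsiDO_surjective hQ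
  rw [PiPsi_toPsiDO, PiPsi_toPsiDO, ← PiJ_bracketX_zero, ← Nat.cast_sub h₁.le,
    ← Nat.cast_sub h₂.le, ← toPsiDO_bracketX_zero (by omega) (by omega), PiPsi_toPsiDO]

/-- Equivariance of the bracket of polynomials. The lifts to operators need not be automorphic. -/
theorem slashP_bracketQ {m ξ₁ ξ₂ : ℕ} (h₁ : m < ξ₁) (h₂ : m < ξ₂) {p q : Polynomial Hol}
    (hp : p.natDegree ≤ m) (hq : q.natDegree ≤ m) (γ : SL(2, ℝ)) :
    slashP (2 * (ξ₁ + ξ₂ - m : ℕ)) γ (bracketQ m ξ₁ ξ₂ p q) =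
      bracketQ m ξ₁ ξ₂ (slashP (2 * ξ₁) γ p) (slashP (2 * ξ₂) γ q) := by
  obtain ⟨P, hP, rfl⟩ := exists_PiPsi_eq (ξ₁ - m) hp
  obtain ⟨Q, hQ, rfl⟩ := exists_PiPsi_eq (ξ₂ - m) hq
  have e : (ξ₁ : ℤ) - m + (ξ₂ - m) = (ξ₁ + ξ₂ - m : ℕ) - m := by omega
  rw [← PiPsi_slash h₁ hP, ← PiPsi_slash h₂ hQ, ← PiPsi_lie h₁ h₂ hP hQ,
    ← PiPsi_lie h₁ h₂ (hP.slash γ) (hQ.slash γ), ← PsiDO.slash_lie, e,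
    PiPsi_slash (by omega) ((hP.lie hQ).mono (by omega))]

theorem natDegree_bracketQ (m ξ₁ ξ₂ : ℕ) (p q : Polynomial Hol) :
    (bracketQ m ξ₁ ξ₂ p q).natDegree ≤ m := by
  refine Polynomial.natDegree_le_iff_coeff_eq_zero.mpr fun r hr => ?_
  simp only [bracketQ, Polynomial.finsetSum_coeff, Polynomial.coeff_monomial, Finset.sum_ite_eq',
    Finset.mem_range]
  exact if_neg (by omega)

theorem bracketQ_mem {Γ : Subgroup SL(2, ℝ)} {m ξ₁ ξ₂ : ℕ} (h₁ : m < ξ₁) (h₂ : m < ξ₂)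
    {p q : Polynomial Hol} (hp : p ∈ QP Γ m ((2 * ξ₁ : ℕ) : ℤ))
    (hq : q ∈ QP Γ m ((2 * ξ₂ : ℕ) : ℤ)) :
    bracketQ m ξ₁ ξ₂ p q ∈ QP Γ m ((2 * (ξ₁ + ξ₂ - m) : ℕ) : ℤ) := by
  refine ⟨natDegree_bracketQ m ξ₁ ξ₂ p q, fun γ hγ => ?_⟩
  have h3 := hp.2 γ hγ
  have h4 := hq.2 γ hγ
  have h5 := slashP_bracketQ h₁ h₂ hp.1 hq.1 γ
  rw [Nat.cast_mul, Nat.cast_ofNat] at h3 h4 ⊢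
  rw [h5, h3, h4]

theorem bracketQ_add_swap (m ξ₁ ξ₂ : ℕ) (p q : Polynomial Hol) :
    bracketQ m ξ₁ ξ₂ p q + bracketQ m ξ₂ ξ₁ q p = 0 := by
  simp only [bracketQ, ← Finset.sum_add_distrib, ← map_add, ← smul_add]
  refine Finset.sum_eq_zero fun r _ => (congrArg _ (Finset.sum_eq_zero fun i _ =>
    Finset.sum_eq_zero fun j _ => ?_)).trans (map_zero _)
  rw [sub_add_sub_cancel, sub_self, smul_zero]

theorem bracketQ_add_left (m ξ₁ ξ₂ : ℕ) (p p' q : Polynomial Hol) :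
    bracketQ m ξ₁ ξ₂ (p + p') q = bracketQ m ξ₁ ξ₂ p q + bracketQ m ξ₁ ξ₂ p' q := by
  simp only [bracketQ, ← Finset.sum_add_distrib, ← map_add, ← smul_add, Polynomial.coeff_add,
    PsiDO.D_iterate_add, mul_add, add_mul]
  refine Finset.sum_congr rfl fun r _ => congrArg _ (Finset.sum_congr rfl fun i _ =>
    Finset.sum_congr rfl fun j _ => congrArg _ ?_)
  rw [smul_add, smul_add]
  abel

theorem bracketQ_smul_left (m ξ₁ ξ₂ : ℕ) (c : ℂ) (p q : Polynomial Hol) :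
    bracketQ m ξ₁ ξ₂ (c • p) q = c • bracketQ m ξ₁ ξ₂ p q := by
  simp only [bracketQ, Finset.smul_sum, Polynomial.smul_monomial, Polynomial.coeff_smul,
    D_iterate_eq, map_smul, smul_mul_assoc, mul_smul_comm]
  refine Finset.sum_congr rfl fun r _ => congrArg _ (Finset.sum_congr rfl fun i _ =>
    Finset.sum_congr rfl fun j _ => ?_)
  rw [smul_comm c, smul_sub c, smul_comm c, smul_comm c]

theorem bracketQ_add_right (m ξ₁ ξ₂ : ℕ) (p q q' : Polynomial Hol) :
    bracketQ m ξ₁ ξ₂ p (q + q') = bracketQ m ξ₁ ξ₂ p q + bracketQ m ξ₁ ξ₂ p q' := by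
  simp only [bracketQ, ← Finset.sum_add_distrib, ← map_add, ← smul_add, Polynomial.coeff_add,
    PsiDO.D_iterate_add, mul_add, add_mul]
  refine Finset.sum_congr rfl fun r _ => congrArg _ (Finset.sum_congr rfl fun i _ =>
    Finset.sum_congr rfl fun j _ => congrArg _ ?_)
  rw [smul_add, smul_add]
  abel

theorem bracketQ_smul_right (m ξ₁ ξ₂ : ℕ) (c : ℂ) (p q : Polynomial Hol) :
    bracketQ m ξ₁ ξ₂ p (c • q) = c • bracketQ m ξ₁ ξ₂ p q := by
  simp only [bracketQ, Finset.smul_sum, Polynomial.smul_monomial, Polynomial.coeff_smul,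
    D_iterate_eq, map_smul, smul_mul_assoc, mul_smul_comm]
  refine Finset.sum_congr rfl fun r _ => congrArg _ (Finset.sum_congr rfl fun i _ =>
    Finset.sum_congr rfl fun j _ => ?_)
  rw [smul_comm c, smul_sub c, smul_comm c, smul_comm c]

/-- The Jacobi identity, inherited from the commutator of pseudodifferential operators. -/
theorem bracketQ_jacobi {m ξ₁ ξ₂ ξ₃ : ℕ} (h₁ : m < ξ₁) (h₂ : m < ξ₂) (h₃ : m < ξ₃)
    {p q s : Polynomial Hol} (hp : p.natDegree ≤ m) (hq : q.natDegree ≤ m)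
    (hs : s.natDegree ≤ m) :
    bracketQ m ξ₁ (ξ₂ + ξ₃ - m) p (bracketQ m ξ₂ ξ₃ q s) +
      bracketQ m ξ₂ (ξ₃ + ξ₁ - m) q (bracketQ m ξ₃ ξ₁ s p) +
      bracketQ m ξ₃ (ξ₁ + ξ₂ - m) s (bracketQ m ξ₁ ξ₂ p q) = 0 := by
  obtain ⟨P, hP, rfl⟩ := exists_PiPsi_eq (ξ₁ - m) hp
  obtain ⟨Q, hQ, rfl⟩ := exists_PiPsi_eq (ξ₂ - m) hq
  obtain ⟨S, hS, rfl⟩ := exists_PiPsi_eq (ξ₃ - m) hs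
  have key : ∀ {a b c : ℕ} {A B C : PsiDO}, m < a → m < b → m < c →
      A.OrderLE (-(a - m)) → B.OrderLE (-(b - m)) → C.OrderLE (-(c - m)) →
      bracketQ m a (b + c - m) (PiPsi (a - m) m A)
        (bracketQ m b c (PiPsi (b - m) m B) (PiPsi (c - m) m C)) =
          PiPsi (a - m + (b - m) + (c - m)) m ⁅A, ⁅B, C⁆⁆ := by
    intro a b c A B C ha hb hc hA hB hC
    have e : (b : ℤ) - m + (c - m) = (b + c - m : ℕ) - m := by omega
    rw [← PiPsi_lie hb hc hB hC, e,
      ← PiPsi_lie ha (by omega) hA ((hB.lie hC).mono (by omega)), ← e, add_assoc]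
  rw [key h₁ h₂ h₃ hP hQ hS, key h₂ h₃ h₁ hQ hS hP, key h₃ h₁ h₂ hS hP hQ,
    show (ξ₂ : ℤ) - m + (ξ₃ - m) + (ξ₁ - m) = ξ₁ - m + (ξ₂ - m) + (ξ₃ - m) by ring,
    show (ξ₃ : ℤ) - m + (ξ₁ - m) + (ξ₂ - m) = ξ₁ - m + (ξ₂ - m) + (ξ₃ - m) by ring,
    ← PiPsi_add, ← PiPsi_add]
  exact (congrArg _ (PsiDO.jacobi P Q S)).trans (PiPsi_zero _ m)

/-! ### The Lie bracket on the graded space -/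

section Graded

variable (Γ : Subgroup SL(2, ℝ)) (m : ℕ)

/-- The elements of a component of the graded space only depend on the underlying polynomial; this
moves between weights that are equal but not syntactically so. -/
theorem comp_congr {ℓ ℓ' : ℕ} (h : ℓ = ℓ') {p : Polynomial Hol} (hp : p ∈ QP Γ m (ℓ : ℤ))
    (hp' : p ∈ QP Γ m (ℓ' : ℤ)) : comp Γ m ℓ ⟨p, hp⟩ = comp Γ m ℓ' ⟨p, hp'⟩ := by
  subst h
  rfl

/-- The bracket of two components of the graded space: `bracketQ` for weights `2 ξ₁`, `2 ξ₂` with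
`ξ₁, ξ₂ > m`, and zero for all other weights. -/
def gradedBracket (ℓ₁ ℓ₂ : ℕ) : QP Γ m (ℓ₁ : ℤ) →ₗ[ℂ] QP Γ m (ℓ₂ : ℤ) →ₗ[ℂ] QHat Γ m :=
  open Classical in
  if h : (Even ℓ₁ ∧ 2 * m < ℓ₁) ∧ (Even ℓ₂ ∧ 2 * m < ℓ₂) then
    have hmem (F : QP Γ m (ℓ₁ : ℤ)) (G : QP Γ m (ℓ₂ : ℤ)) :
        bracketQ m (ℓ₁ / 2) (ℓ₂ / 2) F G ∈
          QP Γ m ((2 * (ℓ₁ / 2 + ℓ₂ / 2 - m) : ℕ) : ℤ) :=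
      bracketQ_mem (by have := Nat.two_mul_div_two_of_even h.1.1; omega)
        (by have := Nat.two_mul_div_two_of_even h.2.1; omega)
        (by rw [Nat.two_mul_div_two_of_even h.1.1]; exact F.2)
        (by rw [Nat.two_mul_div_two_of_even h.2.1]; exact G.2)
    (LinearMap.mk₂ ℂ (fun F G => (⟨_, hmem F G⟩ : QP Γ m _))
      (fun _ _ _ => Subtype.ext (bracketQ_add_left ..))
      (fun _ _ _ => Subtype.ext (bracketQ_smul_left ..))
      (fun _ _ _ => Subtype.ext (bracketQ_add_right ..))
      (fun _ _ _ => Subtype.ext (bracketQ_smul_right ..))).compr₂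
        (comp Γ m (2 * (ℓ₁ / 2 + ℓ₂ / 2 - m)))
  else 0

/-- The Lie bracket on the graded space of quasimodular polynomials. -/
def lieBracket : QHat Γ m →ₗ[ℂ] QHat Γ m →ₗ[ℂ] QHat Γ m :=
  DirectSum.toModule ℂ ℕ _ fun ℓ₁ =>
    (DirectSum.toModule ℂ ℕ _ fun ℓ₂ => (gradedBracket Γ m ℓ₁ ℓ₂).flip).flip

theorem lieBracket_comp (ℓ₁ ℓ₂ : ℕ) (F : QP Γ m (ℓ₁ : ℤ)) (G : QP Γ m (ℓ₂ : ℤ)) :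
    lieBracket Γ m (comp Γ m ℓ₁ F) (comp Γ m ℓ₂ G) = gradedBracket Γ m ℓ₁ ℓ₂ F G := by
  simp only [lieBracket, DirectSum.toModule_lof, LinearMap.flip_apply]

theorem lieBracket_comp_of_not {ℓ₁ ℓ₂ : ℕ}
    (h : ¬((Even ℓ₁ ∧ 2 * m < ℓ₁) ∧ (Even ℓ₂ ∧ 2 * m < ℓ₂)))
    (F : QP Γ m (ℓ₁ : ℤ)) (G : QP Γ m (ℓ₂ : ℤ)) :
    lieBracket Γ m (comp Γ m ℓ₁ F) (comp Γ m ℓ₂ G) = 0 := by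
  rw [lieBracket_comp, gradedBracket, dif_neg h]
  rfl

theorem lieBracket_comp_two_mul {ξ₁ ξ₂ : ℕ} (h₁ : m < ξ₁) (h₂ : m < ξ₂)
    (F : QP Γ m ((2 * ξ₁ : ℕ) : ℤ)) (G : QP Γ m ((2 * ξ₂ : ℕ) : ℤ)) :
    lieBracket Γ m (comp Γ m (2 * ξ₁) F) (comp Γ m (2 * ξ₂) G) =
      comp Γ m (2 * (ξ₁ + ξ₂ - m)) ⟨bracketQ m ξ₁ ξ₂ F G, bracketQ_mem h₁ h₂ F.2 G.2⟩ := by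
  rw [lieBracket_comp, gradedBracket, dif_pos ⟨⟨even_two_mul _, by omega⟩,
    ⟨even_two_mul _, by omega⟩⟩]
  have e₁ : 2 * ξ₁ / 2 = ξ₁ := by omega
  have e₂ : 2 * ξ₂ / 2 = ξ₂ := by omega
  rw [LinearMap.compr₂_apply, LinearMap.mk₂_apply]
  have e : bracketQ m (2 * ξ₁ / 2) (2 * ξ₂ / 2) F G = bracketQ m ξ₁ ξ₂ F G := by rw [e₁, e₂]
  simp only [e]
  exact comp_congr Γ m (by rw [e₁, e₂]) _ _

theorem lieBracket_add_swap (x y : QHat Γ m) :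
    lieBracket Γ m x y + lieBracket Γ m y x = 0 := by
  induction x using DirectSum.induction_on with
  | zero => simp
  | add x x' hx hx' =>
    rw [map_add, map_add, LinearMap.add_apply, add_add_add_comm, hx, hx', add_zero]
  | of ℓ₁ F =>
  induction y using DirectSum.induction_on with
  | zero => simp
  | add y y' hy hy' =>
    rw [map_add, map_add, LinearMap.add_apply, add_add_add_comm, hy, hy', add_zero]
  | of ℓ₂ G =>
  simp only [← DirectSum.lof_eq_of ℂ]
  by_cases h : (Even ℓ₁ ∧ 2 * m < ℓ₁) ∧ (Even ℓ₂ ∧ 2 * m < ℓ₂)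
  · obtain ⟨⟨h₁, h₁'⟩, h₂, h₂'⟩ := h
    obtain ⟨ξ₁, rfl⟩ := h₁.two_dvd
    obtain ⟨ξ₂, rfl⟩ := h₂.two_dvd
    have e : ξ₁ + ξ₂ - m = ξ₂ + ξ₁ - m := by omega
    have hm := bracketQ_mem (ξ₁ := ξ₁) (ξ₂ := ξ₂) (by omega) (by omega) F.2 G.2
    rw [lieBracket_comp_two_mul Γ m (by omega) (by omega),
      lieBracket_comp_two_mul Γ m (by omega) (by omega),
      comp_congr Γ m (congrArg (2 * ·) e) hm (by rw [← e]; exact hm), ← map_add]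
    exact (congrArg _ (Subtype.ext (bracketQ_add_swap ..))).trans (map_zero _)
  · rw [lieBracket_comp_of_not Γ m h, lieBracket_comp_of_not Γ m (mt And.symm h), add_zero]

theorem lieBracket_self (x : QHat Γ m) : lieBracket Γ m x x = 0 := by
  have h := lieBracket_add_swap Γ m x x
  rw [← two_smul ℂ] at h
  rw [← inv_smul_smul₀ (two_ne_zero (α := ℂ)) (lieBracket Γ m x x), h, smul_zero]

/-- An element of a component of odd or of small weight brackets to zero with everything. -/
theorem lieBracket_comp_left_of_not {ℓ : ℕ} (h : ¬(Even ℓ ∧ 2 * m < ℓ)) (F : QP Γ m (ℓ : ℤ))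
    (x : QHat Γ m) : lieBracket Γ m (comp Γ m ℓ F) x = 0 := by
  induction x using DirectSum.induction_on with
  | zero => simp
  | add x x' hx hx' => rw [map_add, hx, hx', add_zero]
  | of ℓ' G =>
    rw [← DirectSum.lof_eq_of ℂ]
    exact lieBracket_comp_of_not Γ m (fun h' => h h'.1) F G

theorem lieBracket_comp_right_of_not {ℓ : ℕ} (h : ¬(Even ℓ ∧ 2 * m < ℓ)) (F : QP Γ m (ℓ : ℤ))
    (x : QHat Γ m) : lieBracket Γ m x (comp Γ m ℓ F) = 0 := by
  have h' := lieBracket_add_swap Γ m x (comp Γ m ℓ F)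
  rwa [lieBracket_comp_left_of_not Γ m h, add_zero] at h'

theorem lieBracket_jacobi_comp {ξ₁ ξ₂ ξ₃ : ℕ} (h₁ : m < ξ₁) (h₂ : m < ξ₂) (h₃ : m < ξ₃)
    (F : QP Γ m ((2 * ξ₁ : ℕ) : ℤ)) (G : QP Γ m ((2 * ξ₂ : ℕ) : ℤ))
    (H : QP Γ m ((2 * ξ₃ : ℕ) : ℤ)) :
    lieBracket Γ m (comp Γ m _ F) (lieBracket Γ m (comp Γ m _ G) (comp Γ m _ H)) +
      lieBracket Γ m (comp Γ m _ G) (lieBracket Γ m (comp Γ m _ H) (comp Γ m _ F)) +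
      lieBracket Γ m (comp Γ m _ H) (lieBracket Γ m (comp Γ m _ F) (comp Γ m _ G)) = 0 := by
  have key : ∀ {a b c : ℕ} (ha : m < a) (hb : m < b) (hc : m < c)
      (A : QP Γ m ((2 * a : ℕ) : ℤ)) (B : QP Γ m ((2 * b : ℕ) : ℤ))
      (C : QP Γ m ((2 * c : ℕ) : ℤ)) {ℓ : ℕ} (_ : 2 * (a + (b + c - m) - m) = ℓ),
      ∃ hm : bracketQ m a (b + c - m) A (bracketQ m b c B C) ∈ QP Γ m (ℓ : ℤ),
        lieBracket Γ m (comp Γ m _ A) (lieBracket Γ m (comp Γ m _ B) (comp Γ m _ C)) =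
          comp Γ m ℓ ⟨_, hm⟩ := by
    rintro a b c ha hb hc A B C _ rfl
    refine ⟨bracketQ_mem ha (by omega) A.2 (bracketQ_mem hb hc B.2 C.2), ?_⟩
    rw [lieBracket_comp_two_mul Γ m hb hc, lieBracket_comp_two_mul Γ m ha (by omega)]
  obtain ⟨hm₁, e₁⟩ := key h₁ h₂ h₃ F G H rfl
  obtain ⟨hm₂, e₂⟩ := key h₂ h₃ h₁ G H F (ℓ := 2 * (ξ₁ + (ξ₂ + ξ₃ - m) - m)) (by omega)
  obtain ⟨hm₃, e₃⟩ := key h₃ h₁ h₂ H F G (ℓ := 2 * (ξ₁ + (ξ₂ + ξ₃ - m) - m)) (by omega)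
  rw [e₁, e₂, e₃, ← map_add, ← map_add]
  refine (congrArg _ (Subtype.ext ?_)).trans (map_zero _)
  exact bracketQ_jacobi h₁ h₂ h₃ F.2.1 G.2.1 H.2.1

theorem lieBracket_jacobi (x y z : QHat Γ m) :
    lieBracket Γ m x (lieBracket Γ m y z) + lieBracket Γ m y (lieBracket Γ m z x) +
      lieBracket Γ m z (lieBracket Γ m x y) = 0 := by
  induction x using DirectSum.induction_on with
  | zero => simp
  | add x x' hx hx' =>
    have h := congrArg₂ (· + ·) hx hx'
    simp only [map_add, LinearMap.add_apply, add_zero] at h ⊢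
    rw [← h]
    abel
  | of ℓ₁ F =>
  induction y using DirectSum.induction_on with
  | zero => simp
  | add y y' hy hy' =>
    have h := congrArg₂ (· + ·) hy hy'
    simp only [map_add, LinearMap.add_apply, add_zero] at h ⊢
    rw [← h]
    abel
  | of ℓ₂ G =>
  induction z using DirectSum.induction_on with
  | zero => simp
  | add z z' hz hz' =>
    have h := congrArg₂ (· + ·) hz hz'
    simp only [map_add, LinearMap.add_apply, add_zero] at h ⊢
    rw [← h]
    abel
  | of ℓ₃ H =>
  simp only [← DirectSum.lof_eq_of ℂ]
  by_cases h₁ : Even ℓ₁ ∧ 2 * m < ℓ₁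
  swap
  · simp only [lieBracket_comp_left_of_not Γ m h₁, lieBracket_comp_right_of_not Γ m h₁, map_zero,
      add_zero]
  by_cases h₂ : Even ℓ₂ ∧ 2 * m < ℓ₂
  swap
  · simp only [lieBracket_comp_left_of_not Γ m h₂, lieBracket_comp_right_of_not Γ m h₂, map_zero,
      add_zero]
  by_cases h₃ : Even ℓ₃ ∧ 2 * m < ℓ₃
  swap
  · simp only [lieBracket_comp_left_of_not Γ m h₃, lieBracket_comp_right_of_not Γ m h₃, map_zero,
      add_zero]
  obtain ⟨ξ₁, rfl⟩ := h₁.1.two_dvd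
  obtain ⟨ξ₂, rfl⟩ := h₂.1.two_dvd
  obtain ⟨ξ₃, rfl⟩ := h₃.1.two_dvd
  exact lieBracket_jacobi_comp Γ m (by omega) (by omega) (by omega) F G H

end Graded

/-! ### Automorphic operators and Jacobi-like forms -/

theorem PiPsi_mem {Γ : Subgroup SL(2, ℝ)} {m ξ : ℕ} (hξ : m < ξ) {P : PsiDO}
    (hP : P ∈ AutPsiDO Γ (m - ξ)) : PiPsi (ξ - m) m P ∈ QP Γ m (2 * ξ) := by
  refine ⟨natDegree_PiPsi _ m P, fun γ hγ => ?_⟩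
  rw [← PiPsi_slash hξ (hP.1.mono (by omega)), hP.2 γ hγ]

theorem lie_mem_AutPsiDO {Γ : Subgroup SL(2, ℝ)} {a b : ℤ} {P Q : PsiDO}
    (hP : P ∈ AutPsiDO Γ a) (hQ : Q ∈ AutPsiDO Γ b) : ⁅P, Q⁆ ∈ AutPsiDO Γ (a + b) :=
  ⟨hP.1.lie hQ.1, fun γ hγ => by rw [PsiDO.slash_lie, hP.2 γ hγ, hQ.2 γ hγ]⟩

/-- Division by `X^δ` turns Jacobi-like forms of weight `w` into those of weight `w + 2 δ`. -/
theorem X_pow_mul_mem_JForm_iff {Γ : Subgroup SL(2, ℝ)} {w : ℤ} {δ : ℕ} {F : PowerSeries Hol} :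
    PowerSeries.X ^ δ * F ∈ JForm Γ w δ ↔ ∀ γ ∈ Γ, slashJ (w + 2 * δ) γ F = F := by
  refine ⟨fun h γ hγ => ?_, fun h => ⟨dvd_mul_right _ _, fun γ hγ => ?_⟩⟩
  · have h1 := h.2 γ hγ
    rw [slashJ_X_pow_mul] at h1
    ext1 k
    simpa only [PowerSeries.coeff_X_pow_mul] using congrArg (PowerSeries.coeff (k + δ)) h1
  · rw [slashJ_X_pow_mul, h γ hγ]

theorem PiJ_mem {Γ : Subgroup SL(2, ℝ)} {m ξ δ : ℕ} {Φ : PowerSeries Hol}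
    (hΦ : Φ ∈ JForm Γ (2 * ((ξ : ℤ) - m - δ)) δ) : PiJ δ m Φ ∈ QP Γ m (2 * ξ) := by
  obtain ⟨F, rfl⟩ := hΦ.1
  rw [X_pow_mul_mem_JForm_iff] at hΦ
  rw [PiJ_X_pow_mul]
  refine ⟨natDegree_PiJ_zero m F, fun γ hγ => ?_⟩
  have h := PiJ_slashJ m (ξ - m) γ F
  rw [sub_add_cancel] at h
  rw [← h, show 2 * ((ξ : ℤ) - m) = 2 * ((ξ : ℤ) - m - δ) + 2 * δ by ring, hΦ γ hγ]

theorem bracketX_mem_JForm {Γ : Subgroup SL(2, ℝ)} {δ₁ δ₂ : ℕ} {ξ₁ ξ₂ : ℤ} (h₁ : 0 < δ₁ + ξ₁)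
    (h₂ : 0 < δ₂ + ξ₂) {Φ₁ Φ₂ : PowerSeries Hol} (hΦ₁ : Φ₁ ∈ JForm Γ (2 * ξ₁) δ₁)
    (hΦ₂ : Φ₂ ∈ JForm Γ (2 * ξ₂) δ₂) :
    bracketX δ₁ δ₂ ξ₁ ξ₂ Φ₁ Φ₂ ∈ JForm Γ (2 * (ξ₁ + ξ₂)) (δ₁ + δ₂) := by
  obtain ⟨F, rfl⟩ := hΦ₁.1
  obtain ⟨G, rfl⟩ := hΦ₂.1
  rw [X_pow_mul_mem_JForm_iff] at hΦ₁ hΦ₂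
  obtain ⟨α, hα⟩ : ∃ α : ℕ, δ₁ + ξ₁ = α := Int.eq_ofNat_of_zero_le h₁.le
  obtain ⟨β, hβ⟩ : ∃ β : ℕ, δ₂ + ξ₂ = β := Int.eq_ofNat_of_zero_le h₂.le
  rw [bracketX_X_pow_mul δ₁ δ₂ hα hβ, X_pow_mul_mem_JForm_iff]
  intro γ hγ
  have h3 := hΦ₁ γ hγ
  have h4 := hΦ₂ γ hγ
  rw [show 2 * ξ₁ + 2 * (δ₁ : ℤ) = 2 * α by rw [← hα]; ring] at h3
  rw [show 2 * ξ₂ + 2 * (δ₂ : ℤ) = 2 * β by rw [← hβ]; ring] at h4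
  rw [show 2 * (ξ₁ + ξ₂) + 2 * ((δ₁ + δ₂ : ℕ) : ℤ) = 2 * (α + β) by push_cast; omega,
    slashJ_bracketX_zero (by omega) (by omega), h3, h4]

theorem PiJ_bracketX {m ξ₁ ξ₂ δ₁ δ₂ : ℕ} (h₁ : m < ξ₁) (h₂ : m < ξ₂) {Φ₁ Φ₂ : PowerSeries Hol}
    (hΦ₁ : PowerSeries.X ^ δ₁ ∣ Φ₁) (hΦ₂ : PowerSeries.X ^ δ₂ ∣ Φ₂) :
    PiJ (δ₁ + δ₂) m (bracketX δ₁ δ₂ ((ξ₁ : ℤ) - m - δ₁) ((ξ₂ : ℤ) - m - δ₂) Φ₁ Φ₂) =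
      bracketQ m ξ₁ ξ₂ (PiJ δ₁ m Φ₁) (PiJ δ₂ m Φ₂) := by
  obtain ⟨F, rfl⟩ := hΦ₁
  obtain ⟨G, rfl⟩ := hΦ₂
  rw [bracketX_X_pow_mul δ₁ δ₂ (α := ξ₁ - m) (β := ξ₂ - m) (by omega) (by omega),
    PiJ_X_pow_mul, PiJ_X_pow_mul, PiJ_X_pow_mul, PiJ_bracketX_zero]

end QuasiLie

end

open QuasiLie in
theorem theorem7p5 (Γ : Subgroup (Matrix.SpecialLinearGroup (Fin 2) ℝ)) (hΓ : DiscreteTopology Γ)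
    (m : ℕ) :
    -- the bracket on quasimodular polynomials is a Lie bracket on the graded space
    (∃ B : QuasiLie.QHat Γ m →ₗ[ℂ] QuasiLie.QHat Γ m →ₗ[ℂ] QuasiLie.QHat Γ m,
      (∀ ξ₁ ξ₂ : ℕ, m < ξ₁ → m < ξ₂ →
        ∀ (F₁ : QuasiLie.QP Γ m ((2 * ξ₁ : ℕ) : ℤ)) (F₂ : QuasiLie.QP Γ m ((2 * ξ₂ : ℕ) : ℤ)),
          ∃ h : QuasiLie.bracketQ m ξ₁ ξ₂ F₁ F₂ ∈
              QuasiLie.QP Γ m ((2 * ξ₁ + 2 * ξ₂ - 2 * m : ℕ) : ℤ),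
            B (QuasiLie.comp Γ m (2 * ξ₁) F₁) (QuasiLie.comp Γ m (2 * ξ₂) F₂) =
              QuasiLie.comp Γ m (2 * ξ₁ + 2 * ξ₂ - 2 * m) ⟨_, h⟩) ∧
      (∀ (ℓ₁ ℓ₂ : ℕ) (F₁ : QuasiLie.QP Γ m (ℓ₁ : ℤ)) (F₂ : QuasiLie.QP Γ m (ℓ₂ : ℤ)),
        ¬ ((Even ℓ₁ ∧ 2 * m < ℓ₁) ∧ (Even ℓ₂ ∧ 2 * m < ℓ₂)) →
          B (QuasiLie.comp Γ m ℓ₁ F₁) (QuasiLie.comp Γ m ℓ₂ F₂) = 0) ∧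
      (∀ x, B x x = 0) ∧
      (∀ x y z, B x (B y z) + B y (B z x) + B z (B x y) = 0)) ∧
    -- compatibility with the bracket on Jacobi-like forms
    (∀ ξ₁ ξ₂ δ₁ δ₂ : ℕ, m < ξ₁ → m < ξ₂ →
      ∀ Φ₁ ∈ QuasiLie.JForm Γ (2 * ((ξ₁ : ℤ) - m - δ₁)) δ₁,
      ∀ Φ₂ ∈ QuasiLie.JForm Γ (2 * ((ξ₂ : ℤ) - m - δ₂)) δ₂,
        QuasiLie.PiJ δ₁ m Φ₁ ∈ QuasiLie.QP Γ m (2 * (ξ₁ : ℤ)) ∧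
        QuasiLie.PiJ δ₂ m Φ₂ ∈ QuasiLie.QP Γ m (2 * (ξ₂ : ℤ)) ∧
        QuasiLie.bracketX δ₁ δ₂ ((ξ₁ : ℤ) - m - δ₁) ((ξ₂ : ℤ) - m - δ₂) Φ₁ Φ₂ ∈
          QuasiLie.JForm Γ (2 * ((ξ₁ : ℤ) + ξ₂ - 2 * m - δ₁ - δ₂)) (δ₁ + δ₂) ∧
        QuasiLie.PiJ (δ₁ + δ₂) m
            (QuasiLie.bracketX δ₁ δ₂ ((ξ₁ : ℤ) - m - δ₁) ((ξ₂ : ℤ) - m - δ₂) Φ₁ Φ₂) =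
          QuasiLie.bracketQ m ξ₁ ξ₂ (QuasiLie.PiJ δ₁ m Φ₁) (QuasiLie.PiJ δ₂ m Φ₂)) ∧
    -- the bracket on power series is transported from the commutator
    (∀ (δ₁ δ₂ : ℕ) (ξ₁ ξ₂ : ℤ), 0 < δ₁ + ξ₁ → 0 < δ₂ + ξ₂ →
      ∀ F G : PowerSeries QuasiLie.Hol, PowerSeries.X ^ δ₁ ∣ F → PowerSeries.X ^ δ₂ ∣ G →
        QuasiLie.toPsiDO (ξ₁ + ξ₂) (QuasiLie.bracketX δ₁ δ₂ ξ₁ ξ₂ F G) =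
          (QuasiLie.toPsiDO ξ₁ F).commutator (QuasiLie.toPsiDO ξ₂ G)) ∧
    -- compatibility with the commutator on automorphic pseudodifferential operators
    (∀ ξ₁ ξ₂ : ℕ, m < ξ₁ → m < ξ₂ →
      ∀ Ψ₁ ∈ QuasiLie.AutPsiDO Γ ((m : ℤ) - ξ₁), ∀ Ψ₂ ∈ QuasiLie.AutPsiDO Γ ((m : ℤ) - ξ₂),
        QuasiLie.PiPsi ((ξ₁ : ℤ) - m) m Ψ₁ ∈ QuasiLie.QP Γ m (2 * (ξ₁ : ℤ)) ∧
        QuasiLie.PiPsi ((ξ₂ : ℤ) - m) m Ψ₂ ∈ QuasiLie.QP Γ m (2 * (ξ₂ : ℤ)) ∧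
        Ψ₁.commutator Ψ₂ ∈ QuasiLie.AutPsiDO Γ (2 * (m : ℤ) - ξ₁ - ξ₂) ∧
        QuasiLie.PiPsi ((ξ₁ : ℤ) + ξ₂ - 2 * m) m (Ψ₁.commutator Ψ₂) =
          QuasiLie.bracketQ m ξ₁ ξ₂
            (QuasiLie.PiPsi ((ξ₁ : ℤ) - m) m Ψ₁) (QuasiLie.PiPsi ((ξ₂ : ℤ) - m) m Ψ₂)) := by
  refine ⟨⟨lieBracket Γ m, fun ξ₁ ξ₂ h₁ h₂ F₁ F₂ => ?_, fun ℓ₁ ℓ₂ F₁ F₂ h =>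
    lieBracket_comp_of_not Γ m h F₁ F₂, lieBracket_self Γ m, lieBracket_jacobi Γ m⟩,
    fun ξ₁ ξ₂ δ₁ δ₂ h₁ h₂ Φ₁ hΦ₁ Φ₂ hΦ₂ => ⟨PiJ_mem hΦ₁, PiJ_mem hΦ₂, ?_,
      PiJ_bracketX h₁ h₂ hΦ₁.1 hΦ₂.1⟩,
    fun δ₁ δ₂ ξ₁ ξ₂ h₁ h₂ F G hF hG => toPsiDO_bracketX h₁ h₂ hF hG,
    fun ξ₁ ξ₂ h₁ h₂ Ψ₁ hΨ₁ Ψ₂ hΨ₂ => ⟨PiPsi_mem h₁ hΨ₁, PiPsi_mem h₂ hΨ₂, ?_, ?_⟩⟩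
  · have e : 2 * (ξ₁ + ξ₂ - m) = 2 * ξ₁ + 2 * ξ₂ - 2 * m := by omega
    have hm := bracketQ_mem h₁ h₂ F₁.2 F₂.2
    have hm' : bracketQ m ξ₁ ξ₂ F₁ F₂ ∈ QP Γ m ((2 * ξ₁ + 2 * ξ₂ - 2 * m : ℕ) : ℤ) := by
      rwa [e] at hm
    exact ⟨hm', (lieBracket_comp_two_mul Γ m h₁ h₂ F₁ F₂).trans (comp_congr Γ m e hm hm')⟩
  · rw [show 2 * ((ξ₁ : ℤ) + ξ₂ - 2 * m - δ₁ - δ₂) =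
      2 * ((ξ₁ : ℤ) - m - δ₁ + ((ξ₂ : ℤ) - m - δ₂)) by ring]
    exact bracketX_mem_JForm (by omega) (by omega) hΦ₁ hΦ₂
  · rw [show 2 * (m : ℤ) - ξ₁ - ξ₂ = m - ξ₁ + (m - ξ₂) by ring]
    exact lie_mem_AutPsiDO hΨ₁ hΨ₂
  · rw [show (ξ₁ : ℤ) + ξ₂ - 2 * m = ξ₁ - m + (ξ₂ - m) by ring]
    exact PiPsi_lie h₁ h₂ (hΨ₁.1.mono (by omega)) (hΨ₂.1.mono (by omega))
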